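/- Let $\mathbb D$ be the open unit disk, $\mathbb T$ the unit circle, $1<p<\infty$ and $\frac1p+\frac1q=1$. Let $g\in H^p$ be an outer function, that is, $g(z)=c\exp\Big(\frac1{2\pi}\int_{-\pi}^{\pi}\frac{e^{it}+z}{e^{it}-z}\log\varphi(e^{it})\,dt\Big)$ on $\mathbb D$ with $|c|=1$, $\varphi>0$ and $\log\varphi\in L^1(\mathbb T)$. Let $I$ be an inner function, that is, a bounded holomorphic function on $\mathbb D$ whose boundary values have modulus $1$ a.e. on $\mathbb T$, and let $$\sigma(I)=\{\lambda\in\overline{\mathbb D}:\liminf_{z\to\lambda,\ z\in\mathbb D}|I(z)|=0\}$$ be its spectrum. Let $H^p(|g|^p)$ be the space of functions $f$ holomorphic in $\mathbb D$ with $$\sup_{0<r<1}\frac1{2\pi}\int_{-\pi}^{\pi}|f(re^{it})|^p|g(re^{it})|^p\,dt<\infty,$$ and let $K^p_I(|g|^p)$ be the set of all $f\in H^p(|g|^p)$ for which there is $\psi\in H^p(|g|^p)$ with $\psi(0)=0$ and $f=I\overline{\psi}$ a.e. on $\mathbb T$ (in the sense of boundary values). Let $\Gamma=\{e^{it}:a\le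 t\le b\}$, $a<b\le a+2\pi$, be a closed arc of $\mathbb T$ not meeting $\sigma(I)$. If there exists $s>q$ with $1/g\in L^s(\Gamma)$, then every $f\in K^p_I(|g|^p)$ extends analytically through $\Gamma$: there are an open set $U\subset\mathbb C$ containing $\mathbb D$ and the interior of $\Gamma$ relative to $\mathbb T$, and an analytic function $F$ on $U$, with $F=f$ on $\mathbb D$. -/

import Mathlib

open Set Filter Topology MeasureTheory Metric
open scoped ENNReal

noncomputable section

/-- `F` is a boundary function of `f`: for almost every `t`, the radial limit of `f` at `e^{it}`
exists and equals `F (e^{it})`.  Here `circleMap 0 r t = r * e^{it}`. -/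
def HasBoundaryFunction (f F : ℂ → ℂ) : Prop :=
  ∀ᵐ t : ℝ, Tendsto (fun r : ℝ => f (circleMap 0 r t)) (𝓝[<] 1) (𝓝 (F (circleMap 0 1 t)))

/-- The weighted Hardy space `H^p(|g|^p)` of the unit disk: functions holomorphic in the disk with
`sup_{0<r<1} (1/2π) ∫ |f(re^{it})|^p |g(re^{it})|^p dt < ∞`. -/
def WeightedHardySpace (p : ℝ) (g : ℂ → ℂ) : Set (ℂ → ℂ) :=
  {f | DifferentiableOn ℂ f (ball 0 1) ∧
    BddAbove ((fun r : ℝ => Real.circleAverage (fun z => ‖f z‖ ^ p * ‖g z‖ ^ p) 0 r) '' Ioo 0 1)}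

/-- The Hardy space `H^p` of the unit disk. -/
def HardySpace (p : ℝ) : Set (ℂ → ℂ) :=
  {f | DifferentiableOn ℂ f (ball 0 1) ∧
    BddAbove ((fun r : ℝ => Real.circleAverage (fun z => ‖f z‖ ^ p) 0 r) '' Ioo 0 1)}

/-- Inner functions: bounded holomorphic functions in the disk whose boundary values have modulus
one almost everywhere on the circle. -/
def IsInner (I : ℂ → ℂ) : Prop :=
  DifferentiableOn ℂ I (ball 0 1) ∧ (∃ C : ℝ, ∀ z ∈ ball (0 : ℂ) 1, ‖I z‖ ≤ C) ∧
    ∃ I' : ℂ → ℂ, HasBoundaryFunction I I' ∧ ∀ᵐ t : ℝ, ‖I' (circleMap 0 1 t)‖ = 1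

/-- Outer functions: `g(z) = c * exp((1/2π) ∫ (e^{it} + z)/(e^{it} - z) * log φ(e^{it}) dt)` in the
disk, with `|c| = 1`, `φ > 0` on the circle and `log φ` integrable on the circle. -/
def IsOuter (g : ℂ → ℂ) : Prop :=
  ∃ (c : ℂ) (φ : ℂ → ℝ), ‖c‖ = 1 ∧ (∀ ζ ∈ sphere (0 : ℂ) 1, 0 < φ ζ) ∧
    CircleIntegrable (fun ζ => Real.log (φ ζ)) 0 1 ∧
    ∀ z ∈ ball (0 : ℂ) 1, g z = c * Complex.exp
      (Real.circleAverage (fun ζ => (ζ + z) / (ζ - z) * (Real.log (φ ζ) : ℂ)) 0 1)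

/-- The spectrum `σ(I)`: points `ζ` of the closed disk with `liminf_{z → ζ, |z| < 1} |I z| = 0`. -/
def innerSpectrum (I : ℂ → ℂ) : Set ℂ :=
  {ζ ∈ closedBall (0 : ℂ) 1 | liminf (fun z => ‖I z‖ₑ) (𝓝[ball 0 1] ζ) = 0}

/-- `K^p_I(|g|^p) = H^p(|g|^p) ∩ I * conj (H^p_0(|g|^p))`, where `H^p_0(|g|^p)` consists of the
functions in `H^p(|g|^p)` vanishing at the origin, and the equality `f = I * conj ψ` is understood
for the boundary values almost everywhere on the circle. -/
def WeightedModelSpace (p : ℝ) (g I : ℂ → ℂ) : Set (ℂ → ℂ) :=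
  {f | f ∈ WeightedHardySpace p g ∧ ∃ ψ ∈ WeightedHardySpace p g, ψ 0 = 0 ∧
    ∃ f' I' ψ' : ℂ → ℂ, HasBoundaryFunction f f' ∧ HasBoundaryFunction I I' ∧
      HasBoundaryFunction ψ ψ' ∧
      ∀ᵐ t : ℝ, f' (circleMap 0 1 t) =
        I' (circleMap 0 1 t) * (starRingEnd ℂ) (ψ' (circleMap 0 1 t))}

/-- The closed arc `{e^{it} : a ≤ t ≤ b}` of the unit circle. -/
def closedArc (a b : ℝ) : Set ℂ := circleMap 0 1 '' Icc a b

/-- The interior, relative to the unit circle, of a subset `Γ` of the unit circle. -/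
def circleInterior (Γ : Set ℂ) : Set ℂ :=
  {ζ ∈ sphere (0 : ℂ) 1 | Γ ∈ 𝓝[sphere 0 1] ζ}

/-- `f`, holomorphic in the unit disk, extends analytically across the subset `A` of the unit
circle: it agrees in the disk with a function that is analytic on an open set containing the disk
and `A`. -/
def ExtendsAnalyticallyAcross (f : ℂ → ℂ) (A : Set ℂ) : Prop :=
  ∃ (U : Set ℂ) (F : ℂ → ℂ), IsOpen U ∧ ball 0 1 ⊆ U ∧ A ⊆ U ∧ AnalyticOnNhd ℂ F U ∧
    EqOn F f (ball 0 1)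

end

/-!
The theorem is a reflection principle. Write `ζ₀` for an interior point of the arc `Γ`. Off its
spectrum `I` is bounded away from zero, so `h = ψ / I` is holomorphic in the disk near `ζ₀`, and
since `|I| = 1` on the circle, the relation `f = I * conj ψ` says that `f` and `h` have complex
conjugate boundary values near `ζ₀`. Then `f` inside the circle and `conj (h (1 / conj z))` outside
it should be one analytic function, provided both attain their boundary values in `L¹` and not only
almost everywhere.

The integrability of `1 / g` gives this. As `g` is outer, `|g| = exp P[u]` with `P[u]` the Poisson
integral of an integrable function `u`; since `P[u]` converges to `u` in the mean
(`eventually_circleAverage_poissonIntegral_sub_le`), `exp u` is the modulus of the boundary function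
of `g`, hence `exp (-s u)` is integrable on `Γ`. Jensen's inequality then yields `|g|⁻ˢ ≤ P[w]` near
`ζ₀` for an integrable `w` (`exists_rpow_neg_le_poissonIntegral`), and Young's inequality turns
`|f|^ρ = (|f g| * |g|⁻¹)^ρ` with `1/ρ = 1/p + 1/s` into a bound by a function with bounded circular
means. Because `s > q`, one has `ρ > 1`, so the functions `t ↦ f (r e^{it})` are bounded in `L^ρ` of
a small arc, hence uniformly integrable, and converge in `L¹`.

For the gluing, the coordinate `z = e^{iw}` replaces the circle by the real axis. Convergence in
`L¹` makes a primitive of `f (e^{iw})` extend continuously to the axis, where it is a primitive of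
the boundary function (`exists_primitive_continuousOn_boundary`). The primitive of `f` and the
reflected primitive of `h` therefore fit together continuously, hence holomorphically by Painlevé's
theorem, and the derivative continues `f` (`exists_analytic_extension_of_conj_boundary`). The local
continuations agree on overlaps by the identity theorem (`extendsAnalyticallyAcross_of_local`).
-/

/-! ### The Poisson integral -/

/-- The Poisson integral of a function on the unit circle. -/
noncomputable def poissonIntegral (u : ℂ → ℝ) (z : ℂ) : ℝ :=
  Real.circleAverage (fun ζ => poissonKernel 0 z ζ * u ζ) 0 1

lemma poissonKernel_zero_nonneg {z ζ : ℂ} (hz : z ∈ ball (0 : ℂ) 1) (hζ : ζ ∈ sphere (0 : ℂ) 1) :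
    0 ≤ poissonKernel 0 z ζ := by
  simp only [mem_ball_zero_iff, mem_sphere_zero_iff_norm] at hz hζ
  simp only [poissonKernel_def, sub_zero, hζ]
  have : ‖z‖ ^ 2 ≤ 1 := by nlinarith [norm_nonneg z]
  apply div_nonneg <;> nlinarith [sq_nonneg ‖ζ - z‖]

lemma continuousOn_poissonKernel_sphere {z : ℂ} (hz : z ∈ ball (0 : ℂ) 1) :
    ContinuousOn (poissonKernel 0 z) (sphere (0 : ℂ) 1) := by
  rw [poissonKernel_eq_re_herglotzRieszKernel]
  have := continuousOn_herglotzRieszKernel_sphere (c := 0) (R := 1) hz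
  rw [abs_one] at this
  exact Complex.continuous_re.comp_continuousOn this

lemma CircleIntegrable.poissonKernel_mul {u : ℂ → ℝ} (hu : CircleIntegrable u 0 1) {z : ℂ}
    (hz : z ∈ ball (0 : ℂ) 1) : CircleIntegrable (fun ζ => poissonKernel 0 z ζ * u ζ) 0 1 := by
  have h : ContinuousOn (poissonKernel 0 z) (sphere (0 : ℂ) |1|) := by
    rw [abs_one]
    exact continuousOn_poissonKernel_sphere hz
  exact CircleIntegrable.continuousOn_smul hu h

lemma CircleIntegrable.real_const_mul {u : ℂ → ℝ} (hu : CircleIntegrable u 0 1) (c : ℝ) :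
    CircleIntegrable (fun ζ => c * u ζ) 0 1 :=
  IntervalIntegrable.const_mul hu c

/-- The Poisson integral is the real part of the Herglotz integral. -/
lemma poissonIntegral_eq_re {u : ℂ → ℝ} (hu : CircleIntegrable u 0 1) {z : ℂ}
    (hz : z ∈ ball (0 : ℂ) 1) : poissonIntegral u z =
      (Real.circleAverage (fun ζ => herglotzRieszKernel 0 z ζ • (u ζ : ℂ)) 0 1).re := by
  rw [re_circleAverage_herglotzRieszKernel_smul hu hz, ← poissonKernel_eq_re_herglotzRieszKernel]
  rfl

lemma CircleIntegrable.complex_ofReal {u : ℂ → ℝ} (hu : CircleIntegrable u 0 1) :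
    CircleIntegrable (fun ζ => (u ζ : ℂ)) 0 1 := by
  simp only [CircleIntegrable, intervalIntegrable_iff] at hu ⊢
  exact Complex.ofRealCLM.integrable_comp hu

lemma continuousOn_poissonIntegral {u : ℂ → ℝ} (hu : CircleIntegrable u 0 1) :
    ContinuousOn (poissonIntegral u) (ball 0 1) := by
  have h := (differentiableOn_circleAverage_herglotzRieszKernel_smul hu.complex_ofReal).continuousOn
  exact (Complex.continuous_re.comp_continuousOn h).congr fun z hz => poissonIntegral_eq_re hu hz

lemma circleIntegrable_poissonIntegral {u : ℂ → ℝ} (hu : CircleIntegrable u 0 1) {r : ℝ}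
    (hr : r ∈ Ioo (0 : ℝ) 1) : CircleIntegrable (poissonIntegral u) 0 r := by
  apply ContinuousOn.circleIntegrable hr.1.le
  exact (continuousOn_poissonIntegral hu).mono (sphere_subset_ball hr.2)

/-- The means of a Poisson integral over concentric circles all equal the mean of the boundary
function, by the mean value property of the Herglotz integral. -/
lemma circleAverage_poissonIntegral {u : ℂ → ℝ} (hu : CircleIntegrable u 0 1) {r : ℝ}
    (hr : r ∈ Ioo (0 : ℝ) 1) :
    Real.circleAverage (poissonIntegral u) 0 r = Real.circleAverage u 0 1 := by
  set H : ℂ → ℂ := fun z => Real.circleAverage (fun ζ => herglotzRieszKernel 0 z ζ • (u ζ : ℂ)) 0 1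
  have hH : DifferentiableOn ℂ H (ball 0 1) :=
    differentiableOn_circleAverage_herglotzRieszKernel_smul hu.complex_ofReal
  have hsub : closedBall (0 : ℂ) r ⊆ ball 0 1 := closedBall_subset_ball hr.2
  have hd : DiffContOnCl ℂ H (ball 0 |r|) := by
    rw [abs_of_pos hr.1]
    exact (hH.mono hsub).diffContOnCl_ball subset_rfl
  have h1 : Real.circleAverage (poissonIntegral u) 0 r
      = Real.circleAverage (Complex.reCLM ∘ H) 0 r := by
    apply Real.circleAverage_congr_sphere
    intro z hz
    rw [abs_of_pos hr.1] at hz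
    exact poissonIntegral_eq_re hu (sphere_subset_ball hr.2 hz)
  have hci : CircleIntegrable H 0 r := by
    apply ContinuousOn.circleIntegrable hr.1.le
    exact hH.continuousOn.mono (sphere_subset_ball hr.2)
  rw [h1, Complex.reCLM.circleAverage_comp_comm hci, hd.circleAverage, Complex.reCLM_apply,
    ← poissonIntegral_eq_re hu (mem_ball_self one_pos)]
  apply Real.circleAverage_congr_sphere
  intro z hz
  rw [abs_one, mem_sphere_zero_iff_norm] at hz
  simp [poissonKernel_def, hz]

lemma poissonIntegral_const (c : ℝ) {z : ℂ} (hz : z ∈ ball (0 : ℂ) 1) :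
    poissonIntegral (fun _ => c) z = c := by
  have h : InnerProductSpace.HarmonicOnNhd (fun _ : ℂ => c) (closedBall 0 1) :=
    fun x _ => InnerProductSpace.harmonicAt_const c
  exact h.circleAverage_poissonKernel_smul hz

lemma poissonIntegral_mono {u v : ℂ → ℝ} (hu : CircleIntegrable u 0 1)
    (hv : CircleIntegrable v 0 1) (h : ∀ ζ ∈ sphere (0 : ℂ) 1, u ζ ≤ v ζ) {z : ℂ}
    (hz : z ∈ ball (0 : ℂ) 1) : poissonIntegral u z ≤ poissonIntegral v z := by
  apply Real.circleAverage_mono (hu.poissonKernel_mul hz) (hv.poissonKernel_mul hz)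
  intro ζ hζ
  rw [abs_one] at hζ
  exact mul_le_mul_of_nonneg_left (h ζ hζ) (poissonKernel_zero_nonneg hz hζ)

lemma poissonIntegral_add {u v : ℂ → ℝ} (hu : CircleIntegrable u 0 1)
    (hv : CircleIntegrable v 0 1) {z : ℂ} (hz : z ∈ ball (0 : ℂ) 1) :
    poissonIntegral (fun ζ => u ζ + v ζ) z = poissonIntegral u z + poissonIntegral v z := by
  unfold poissonIntegral
  rw [← Real.circleAverage_fun_add (hu.poissonKernel_mul hz) (hv.poissonKernel_mul hz)]
  simp only [mul_add]

lemma poissonIntegral_const_mul (c : ℝ) (u : ℂ → ℝ) (z : ℂ) :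
    poissonIntegral (fun ζ => c * u ζ) z = c * poissonIntegral u z := by
  unfold poissonIntegral
  rw [← smul_eq_mul, ← Real.circleAverage_fun_smul]
  congr 1
  ext ζ
  rw [smul_eq_mul]; ring

lemma abs_poissonIntegral_le {u : ℂ → ℝ} (hu : CircleIntegrable u 0 1) {z : ℂ}
    (hz : z ∈ ball (0 : ℂ) 1) : |poissonIntegral u z| ≤ poissonIntegral (fun ζ => |u ζ|) z := by
  rw [abs_le]
  constructor
  · have := poissonIntegral_mono (hu.fun_abs.real_const_mul (-1)) hu
      (fun ζ _ => by simpa using neg_abs_le (u ζ)) hz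
    rw [poissonIntegral_const_mul] at this
    linarith
  · exact poissonIntegral_mono hu hu.fun_abs (fun ζ _ => le_abs_self _) hz

/-- Jensen's inequality for the Poisson kernel, integrated from the tangent line of `exp`. -/
lemma exp_poissonIntegral_le {v : ℂ → ℝ} (hv : CircleIntegrable v 0 1)
    (hev : CircleIntegrable (fun ζ => Real.exp (v ζ)) 0 1) {z : ℂ} (hz : z ∈ ball (0 : ℂ) 1) :
    Real.exp (poissonIntegral v z) ≤ poissonIntegral (fun ζ => Real.exp (v ζ)) z := by
  set m := poissonIntegral v z
  have key := poissonIntegral_mono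
    (u := fun ζ => Real.exp m * (1 - m) + Real.exp m * v ζ)
    ((circleIntegrable_const _ _ _).add (hv.real_const_mul _)) hev (fun ζ _ => ?_) hz
  · rw [poissonIntegral_add (circleIntegrable_const _ _ _) (hv.real_const_mul _) hz,
      poissonIntegral_const _ hz, poissonIntegral_const_mul] at key
    linarith
  · have h1 := Real.add_one_le_exp (v ζ - m)
    have h2 : Real.exp (v ζ) = Real.exp m * Real.exp (v ζ - m) := by
      rw [← Real.exp_add]; ring_nf
    rw [h2]
    nlinarith [Real.exp_pos m]

/-- Away from the pole the Poisson kernel is small. -/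
lemma poissonKernel_zero_le_of_dist {z ζ ζ₀ : ℂ} {δ : ℝ} (hδ : 0 < δ) (hz : z ∈ ball (0 : ℂ) 1)
    (hζ : ζ ∈ sphere (0 : ℂ) 1) (h1 : δ ≤ dist ζ ζ₀) (h2 : dist z ζ₀ ≤ δ / 2) :
    poissonKernel 0 z ζ ≤ 4 * (1 - ‖z‖ ^ 2) / δ ^ 2 := by
  have h3 : δ / 2 ≤ ‖ζ - z‖ := by
    rw [← dist_eq_norm]
    linarith [dist_triangle ζ z ζ₀]
  simp only [mem_ball_zero_iff, mem_sphere_zero_iff_norm] at hz hζ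
  simp only [poissonKernel_def, sub_zero, hζ]
  have : ‖z‖ ^ 2 ≤ 1 := by nlinarith [norm_nonneg z]
  have h4 : 0 < ‖ζ - z‖ := by linarith
  rw [div_le_div_iff₀ (by positivity) (by positivity)]
  have : δ ^ 2 ≤ 4 * ‖ζ - z‖ ^ 2 := by nlinarith
  nlinarith

/-! ### Boundary convergence of Poisson integrals -/

lemma CircleIntegrable.intervalIntegrable_add_two_pi {u : ℂ → ℝ} (hu : CircleIntegrable u 0 1)
    (a : ℝ) : IntervalIntegrable (fun t => u (circleMap 0 1 t)) volume a (a + 2 * Real.pi) := by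
  have hper : Function.Periodic (fun t => u (circleMap 0 1 t)) (2 * Real.pi) :=
    fun t => by simp only [periodic_circleMap 0 1 t]
  exact hper.intervalIntegrable₀ Real.two_pi_pos.ne' hu _ _

lemma circleAverage_eq_integral_Ioc (u : ℂ → ℝ) (a : ℝ) :
    Real.circleAverage u 0 1 =
      (2 * Real.pi)⁻¹ * ∫ t in Ioc a (a + 2 * Real.pi), u (circleMap 0 1 t) := by
  have hper : Function.Periodic (fun t => u (circleMap 0 1 t)) (2 * Real.pi) :=
    fun t => by simp only [periodic_circleMap 0 1 t]
  rw [Real.circleAverage_def, smul_eq_mul, ← intervalIntegral.integral_of_le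
    (by linarith [Real.two_pi_pos]), hper.intervalIntegral_add_eq a 0, zero_add]

/-- Continuous functions are dense in `L¹` of the circle. -/
lemma CircleIntegrable.exists_continuous_circleAverage_le {u : ℂ → ℝ}
    (hu : CircleIntegrable u 0 1) {ε : ℝ} (hε : 0 < ε) :
    ∃ K : ℂ → ℝ, Continuous K ∧ Real.circleAverage (fun ζ => |u ζ - K ζ|) 0 1 ≤ ε := by
  -- `arg` inverts the parametrization over `(-π, π]`, which transports measurability to the circle
  set I := Ioc (-Real.pi) (-Real.pi + 2 * Real.pi) with hI
  set μ : Measure ℂ := (volume.restrict I).map (circleMap 0 1) with hμ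
  have hmeas : Measurable (circleMap 0 1) := (continuous_circleMap 0 1).measurable
  have hv : IntegrableOn (fun t => u (circleMap 0 1 t)) I volume := by
    have := hu.intervalIntegrable_add_two_pi (-Real.pi)
    rwa [intervalIntegrable_iff_integrableOn_Ioc_of_le (by linarith [Real.two_pi_pos])] at this
  have harg : μ.map Complex.arg = volume.restrict I := by
    rw [hμ, Measure.map_map Complex.measurable_arg hmeas]
    conv_rhs => rw [← Measure.map_id (μ := volume.restrict I)]
    apply Measure.map_congr
    filter_upwards [ae_restrict_mem measurableSet_Ioc] with t ht
    simp only [Function.comp_apply, id, circleMap_zero, Complex.ofReal_one, one_mul]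
    rw [Complex.arg_exp_mul_I]
    exact (toIocMod_eq_self Real.two_pi_pos).2 ht
  have hmsu : AEStronglyMeasurable u μ := by
    have h1 : AEStronglyMeasurable ((fun t => u (circleMap 0 1 t)) ∘ Complex.arg) μ := by
      apply AEStronglyMeasurable.comp_measurable _ Complex.measurable_arg
      rw [harg]
      exact hv.aestronglyMeasurable
    refine h1.congr ?_
    have h2 : ∀ᵐ ζ ∂μ, ‖ζ‖ = 1 := by
      rw [hμ, ae_map_iff hmeas.aemeasurable (measurableSet_eq_fun measurable_norm measurable_const)]
      exact Eventually.of_forall fun t => by simp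
    filter_upwards [h2] with ζ hζ
    have := Complex.norm_mul_exp_arg_mul_I ζ
    rw [hζ] at this
    simp only [Function.comp_apply, circleMap_zero]
    rw [this]
  have hint : Integrable u μ := (integrable_map_measure hmsu hmeas.aemeasurable).2 hv
  obtain ⟨K, hK, -⟩ := hint.exists_boundedContinuous_integral_sub_le
    (ε := 2 * Real.pi * ε) (by positivity)
  refine ⟨K, K.continuous, ?_⟩
  have hmap : ∫ ζ, ‖u ζ - K ζ‖ ∂μ = ∫ t in I, ‖u (circleMap 0 1 t) - K (circleMap 0 1 t)‖ :=
    integral_map hmeas.aemeasurable (hmsu.sub K.continuous.aestronglyMeasurable).norm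
  rw [hmap] at hK
  rw [circleAverage_eq_integral_Ioc _ (-Real.pi), inv_mul_le_iff₀ Real.two_pi_pos]
  exact hK

/-- The Poisson integral of a continuous function converges uniformly to it. -/
lemma eventually_abs_poissonIntegral_sub_le {K : ℂ → ℝ} (hK : Continuous K) {ε : ℝ} (hε : 0 < ε) :
    ∀ᶠ r : ℝ in 𝓝[<] 1, ∀ ζ ∈ sphere (0 : ℂ) 1, |poissonIntegral K (r * ζ) - K ζ| ≤ ε := by
  have hcomp : IsCompact (sphere (0 : ℂ) 1) := isCompact_sphere 0 1
  obtain ⟨M, hM⟩ := hcomp.exists_bound_of_continuousOn hK.continuousOn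
  have huc := hcomp.uniformContinuousOn_of_continuous hK.continuousOn
  obtain ⟨δ, hδ, hKδ⟩ := Metric.uniformContinuousOn_iff.1 huc (ε / 2) (by positivity)
  have hM0 : 0 ≤ M := (norm_nonneg _).trans (hM 1 (by simp))
  have hlim : Tendsto (fun r : ℝ => 2 * M * (4 * (1 - r ^ 2) / δ ^ 2)) (𝓝[<] 1) (𝓝 0) := by
    have : Tendsto (fun r : ℝ => 2 * M * (4 * (1 - r ^ 2) / δ ^ 2)) (𝓝 1)
        (𝓝 (2 * M * (4 * (1 - 1 ^ 2) / δ ^ 2))) := by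
      apply Continuous.tendsto
      fun_prop
    refine Tendsto.mono_left ?_ nhdsWithin_le_nhds
    convert this using 2
    ring
  have e1 : ∀ᶠ r : ℝ in 𝓝[<] 1, 2 * M * (4 * (1 - r ^ 2) / δ ^ 2) < ε / 2 :=
    hlim.eventually_lt_const (by positivity)
  have e2 : ∀ᶠ r : ℝ in 𝓝[<] 1, r ∈ Ioo (max 0 (1 - δ / 2)) 1 :=
    Ioo_mem_nhdsLT (by simp [hδ])
  filter_upwards [e1, e2] with r h1 hr ζ₀ hζ₀
  have hr0 : 0 < r := (le_max_left _ _).trans_lt hr.1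
  have hrδ : 1 - δ / 2 < r := (le_max_right _ _).trans_lt hr.1
  have hn : ‖ζ₀‖ = 1 := by simpa using hζ₀
  have hnz : ‖(r : ℂ) * ζ₀‖ = r := by
    rw [norm_mul, hn, Complex.norm_real, mul_one]
    exact abs_of_pos hr0
  have hz : (r : ℂ) * ζ₀ ∈ ball (0 : ℂ) 1 := by rw [mem_ball_zero_iff, hnz]; exact hr.2
  have hdist : dist ((r : ℂ) * ζ₀) ζ₀ ≤ δ / 2 := by
    have : (r : ℂ) * ζ₀ - ζ₀ = ((r - 1 : ℝ) : ℂ) * ζ₀ := by push_cast; ring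
    rw [dist_eq_norm, this, norm_mul, hn, Complex.norm_real, mul_one, Real.norm_eq_abs,
      abs_of_neg (by linarith [hr.2])]
    linarith
  have hci : CircleIntegrable K 0 1 := hK.continuousOn.circleIntegrable zero_le_one
  have hci' : CircleIntegrable (fun ζ => K ζ - K ζ₀) 0 1 := hci.sub (circleIntegrable_const _ _ _)
  have hsub : poissonIntegral K (r * ζ₀) - K ζ₀
      = poissonIntegral (fun ζ => K ζ - K ζ₀) (r * ζ₀) := by
    have := poissonIntegral_add hci (circleIntegrable_const (-K ζ₀) 0 1) hz
    rw [poissonIntegral_const _ hz] at this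
    simp only [sub_eq_add_neg]
    exact this.symm
  rw [hsub]
  refine (abs_poissonIntegral_le hci' hz).trans ?_
  set η := 2 * M * (4 * (1 - r ^ 2) / δ ^ 2) with hη
  have hη0 : 0 ≤ η := by
    have : 0 ≤ 1 - r ^ 2 := by nlinarith [hr.2]
    positivity
  have hPi : CircleIntegrable (fun ζ => ε / 2 * poissonKernel 0 (r * ζ₀) ζ) 0 1 := by
    have := ((circleIntegrable_const (1 : ℝ) 0 1).poissonKernel_mul hz).real_const_mul (ε / 2)
    simpa using this
  -- near `ζ₀` the oscillation of `K` is small, far from `ζ₀` the kernel is small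
  have hkey : poissonIntegral (fun ζ => |K ζ - K ζ₀|) (r * ζ₀) ≤
      Real.circleAverage (fun ζ => ε / 2 * poissonKernel 0 (r * ζ₀) ζ + η) 0 1 := by
    apply Real.circleAverage_mono (hci'.abs.poissonKernel_mul hz)
      (hPi.add (circleIntegrable_const _ _ _))
    intro ζ hζ
    rw [abs_one] at hζ
    have hP := poissonKernel_zero_nonneg hz hζ
    change poissonKernel 0 (r * ζ₀) ζ * |K ζ - K ζ₀| ≤ ε / 2 * poissonKernel 0 (r * ζ₀) ζ + η
    by_cases hd : dist ζ ζ₀ < δ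
    · have := (hKδ ζ hζ ζ₀ hζ₀ hd).le
      rw [Real.dist_eq] at this
      nlinarith
    · have h3 := poissonKernel_zero_le_of_dist hδ hz hζ (not_lt.1 hd) hdist
      rw [hnz] at h3
      have h4 : |K ζ - K ζ₀| ≤ 2 * M := by
        have := abs_sub (K ζ) (K ζ₀)
        have h5 := hM ζ hζ
        have h6 := hM ζ₀ hζ₀
        rw [Real.norm_eq_abs] at h5 h6
        linarith
      have h7 : poissonKernel 0 (r * ζ₀) ζ * |K ζ - K ζ₀| ≤ η := by
        rw [hη, mul_comm]
        gcongr
      have : 0 ≤ ε / 2 * poissonKernel 0 (r * ζ₀) ζ := by positivity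
      linarith
  refine hkey.trans ?_
  have h8 := poissonIntegral_const (ε / 2) hz
  simp only [poissonIntegral, mul_comm _ (ε / 2)] at h8
  rw [Real.circleAverage_fun_add hPi (circleIntegrable_const _ _ _), h8, Real.circleAverage_const]
  linarith

/-- The Poisson integral of an integrable function converges to it in the mean. -/
lemma eventually_circleAverage_poissonIntegral_sub_le {u : ℂ → ℝ} (hu : CircleIntegrable u 0 1)
    {ε : ℝ} (hε : 0 < ε) : ∀ᶠ r : ℝ in 𝓝[<] 1,
      Real.circleAverage (fun ζ => |poissonIntegral u (r * ζ) - u ζ|) 0 1 ≤ ε := by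
  obtain ⟨K, hK, hKu⟩ := hu.exists_continuous_circleAverage_le (ε := ε / 3) (by positivity)
  have e2 : ∀ᶠ r : ℝ in 𝓝[<] 1, r ∈ Ioo (0 : ℝ) 1 := Ioo_mem_nhdsLT one_pos
  filter_upwards [eventually_abs_poissonIntegral_sub_le hK (ε := ε / 3) (by positivity), e2]
    with r h1 hr
  have hKi : CircleIntegrable K 0 1 := hK.continuousOn.circleIntegrable zero_le_one
  have hv : CircleIntegrable (fun ζ => |u ζ - K ζ|) 0 1 := (hu.sub hKi).abs
  have hmem : ∀ ζ ∈ sphere (0 : ℂ) 1, (r : ℂ) * ζ ∈ ball (0 : ℂ) 1 := by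
    intro ζ hζ
    rw [mem_sphere_zero_iff_norm] at hζ
    rw [mem_ball_zero_iff, norm_mul, hζ, Complex.norm_real, mul_one, Real.norm_eq_abs,
      abs_of_pos hr.1]
    exact hr.2
  have hc : ∀ {w : ℂ → ℝ}, CircleIntegrable w 0 1 →
      CircleIntegrable (fun ζ => poissonIntegral w (r * ζ)) 0 1 := fun hw =>
    ((continuousOn_poissonIntegral hw).comp (by fun_prop) hmem).circleIntegrable zero_le_one
  have hle : Real.circleAverage (fun ζ => |poissonIntegral u (r * ζ) - u ζ|) 0 1 ≤
      Real.circleAverage (fun ζ => poissonIntegral (fun ζ => |u ζ - K ζ|) (r * ζ)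
        + (|u ζ - K ζ| + ε / 3)) 0 1 := by
    apply Real.circleAverage_mono ((hc hu).sub hu).abs
      ((hc hv).add (hv.add (circleIntegrable_const _ _ _)))
    intro ζ hζ
    rw [abs_one] at hζ
    have hz := hmem ζ hζ
    have a1 := h1 ζ hζ
    have a2 := abs_poissonIntegral_le (hu.sub hKi) hz
    have a3 : poissonIntegral u (r * ζ) =
        poissonIntegral (u - K) (r * ζ) + poissonIntegral K (r * ζ) := by
      rw [← poissonIntegral_add (hu.sub hKi) hKi hz]
      simp
    have a4 : poissonIntegral u (r * ζ) - u ζ = poissonIntegral (u - K) (r * ζ)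
        + ((K ζ - u ζ) + (poissonIntegral K (r * ζ) - K ζ)) := by rw [a3]; ring
    have a5 := abs_sub_comm (K ζ) (u ζ)
    simp only [Pi.abs_apply, Pi.sub_apply] at a2 ⊢
    rw [a4]
    refine (abs_add_le _ _).trans (add_le_add a2 ((abs_add_le _ _).trans ?_))
    rw [a5]
    exact add_le_add le_rfl a1
  refine hle.trans ?_
  rw [Real.circleAverage_fun_add (f₂ := fun ζ => |u ζ - K ζ| + ε / 3) (hc hv)
    (hv.add (circleIntegrable_const _ _ _)),
    Real.circleAverage_fun_add hv (circleIntegrable_const _ _ _), Real.circleAverage_const]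
  have h5 := circleAverage_poissonIntegral hv hr
  rw [Real.circleAverage_eq_circleAverage_zero_one] at h5
  simp only [add_zero] at h5
  rw [h5]
  linarith

/-- Along some sequence of radii, the Poisson integral of an integrable function converges to it
almost everywhere. -/
lemma exists_seq_tendsto_poissonIntegral {u : ℂ → ℝ} (hu : CircleIntegrable u 0 1) (a : ℝ) :
    ∃ r : ℕ → ℝ, Tendsto r atTop (𝓝[<] 1) ∧ ∀ᵐ t ∂volume.restrict (Ioc a (a + 2 * Real.pi)),
      Tendsto (fun n => poissonIntegral u (circleMap 0 (r n) t)) atTop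
        (𝓝 (u (circleMap 0 1 t))) := by
  set μ := volume.restrict (Ioc a (a + 2 * Real.pi)) with hμ
  have hum : ∀ {w : ℂ → ℝ}, CircleIntegrable w 0 1 →
      Integrable (fun t => w (circleMap 0 1 t)) μ := fun hw => by
    have := hw.intervalIntegrable_add_two_pi a
    rwa [intervalIntegrable_iff_integrableOn_Ioc_of_le (by linarith [Real.two_pi_pos])] at this
  obtain ⟨ρ, -, hρ, hρlim⟩ := exists_seq_strictMono_tendsto' (show (0 : ℝ) < 1 from one_pos)
  have hρlim' : Tendsto ρ atTop (𝓝[<] 1) :=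
    tendsto_nhdsWithin_iff.2 ⟨hρlim, Eventually.of_forall fun n => (hρ n).2⟩
  have hcm : ∀ n t, circleMap 0 (ρ n) t = (ρ n : ℂ) * circleMap 0 1 t := fun n t => by
    simp [circleMap_zero]
  have hmem : ∀ n, ∀ ζ ∈ sphere (0 : ℂ) 1, (ρ n : ℂ) * ζ ∈ ball (0 : ℂ) 1 := by
    intro n ζ hζ
    rw [mem_sphere_zero_iff_norm] at hζ
    rw [mem_ball_zero_iff, norm_mul, hζ, Complex.norm_real, mul_one, Real.norm_eq_abs,
      abs_of_pos (hρ n).1]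
    exact (hρ n).2
  have hP : ∀ n, CircleIntegrable (fun ζ => poissonIntegral u (ρ n * ζ)) 0 1 := fun n =>
    ((continuousOn_poissonIntegral hu).comp (by fun_prop) (hmem n)).circleIntegrable zero_le_one
  have hmeasure : TendstoInMeasure μ (fun n t => poissonIntegral u (circleMap 0 (ρ n) t)) atTop
      (fun t => u (circleMap 0 1 t)) := by
    simp only [hcm]
    refine tendstoInMeasure_of_tendsto_eLpNorm one_ne_zero
      (fun n => (hum (hP n)).aestronglyMeasurable) (hum hu).aestronglyMeasurable ?_
    have hnorm : ∀ n, eLpNorm ((fun t => poissonIntegral u (ρ n * circleMap 0 1 t)) -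
        fun t => u (circleMap 0 1 t)) 1 μ = ENNReal.ofReal (2 * Real.pi *
          Real.circleAverage (fun ζ => |poissonIntegral u (ρ n * ζ) - u ζ|) 0 1) := by
      intro n
      rw [eLpNorm_one_eq_lintegral_enorm, ← ofReal_integral_norm_eq_lintegral_enorm
        ((hum (hP n)).sub (hum hu)), circleAverage_eq_integral_Ioc _ a,
        mul_inv_cancel_left₀ Real.two_pi_pos.ne']
      rfl
    simp only [hnorm]
    rw [← ENNReal.ofReal_zero]
    refine ENNReal.tendsto_ofReal ?_
    rw [← mul_zero (2 * Real.pi)]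
    refine Tendsto.const_mul _ ?_
    rw [Metric.tendsto_nhds]
    intro ε hε
    filter_upwards [hρlim'.eventually
      (eventually_circleAverage_poissonIntegral_sub_le hu (half_pos hε))] with n hn
    rw [Real.dist_0_eq_abs, abs_of_nonneg]
    · linarith
    · exact Real.circleAverage_nonneg_of_nonneg fun _ _ => abs_nonneg _
  obtain ⟨ns, hns, hae⟩ := hmeasure.exists_seq_tendsto_ae
  exact ⟨ρ ∘ ns, hρlim'.comp hns.tendsto_atTop, hae⟩

/-! ### Weighted Hardy functions near the arc -/

/-- The modulus of an outer function is the exponential of a Poisson integral. -/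
lemma IsOuter.exists_norm_eq {g : ℂ → ℂ} (hg : IsOuter g) :
    ∃ u : ℂ → ℝ, CircleIntegrable u 0 1 ∧
      ∀ z ∈ ball (0 : ℂ) 1, ‖g z‖ = Real.exp (poissonIntegral u z) := by
  obtain ⟨c, φ, hc, -, hφ, hgz⟩ := hg
  refine ⟨fun ζ => Real.log (φ ζ), hφ, fun z hz => ?_⟩
  rw [hgz z hz, norm_mul, hc, one_mul, Complex.norm_exp, poissonIntegral_eq_re hφ hz]
  simp [herglotzRieszKernel_def]

/-- If `|g| = exp P[u]` in the disk, then `exp u` is the modulus of the boundary function of `g`. -/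
lemma HasBoundaryFunction.norm_eq_exp {g G : ℂ → ℂ} {u : ℂ → ℝ} (hG : HasBoundaryFunction g G)
    (hu : CircleIntegrable u 0 1)
    (hgu : ∀ z ∈ ball (0 : ℂ) 1, ‖g z‖ = Real.exp (poissonIntegral u z)) (a : ℝ) :
    ∀ᵐ t ∂volume.restrict (Ioc a (a + 2 * Real.pi)),
      ‖G (circleMap 0 1 t)‖ = Real.exp (u (circleMap 0 1 t)) := by
  obtain ⟨r, hr, hlim⟩ := exists_seq_tendsto_poissonIntegral hu a
  filter_upwards [hlim, ae_restrict_of_ae hG] with t h1 h2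
  have h3 := (h2.comp hr).norm
  have h4 := (Real.continuous_exp.tendsto _).comp h1
  refine tendsto_nhds_unique h3 (h4.congr' ?_)
  have e2 : ∀ᶠ r : ℝ in 𝓝[<] 1, r ∈ Ioo (0 : ℝ) 1 := Ioo_mem_nhdsLT one_pos
  filter_upwards [hr.eventually e2] with n hn
  refine (hgu _ ?_).symm
  rw [mem_ball_zero_iff, norm_circleMap_zero, abs_of_pos hn.1]
  exact hn.2

lemma circleIntegrable_iff_integrableOn_Ioc {u : ℂ → ℝ} (a : ℝ) : CircleIntegrable u 0 1 ↔
    IntegrableOn (fun t => u (circleMap 0 1 t)) (Ioc a (a + 2 * Real.pi)) := by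
  have hper : Function.Periodic (fun t => u (circleMap 0 1 t)) (2 * Real.pi) :=
    fun t => by simp only [periodic_circleMap 0 1 t]
  rw [← intervalIntegrable_iff_integrableOn_Ioc_of_le (by linarith [Real.two_pi_pos]),
    hper.intervalIntegrable_iff (t₂ := 0), zero_add]
  rfl

lemma CircleIntegrable.indicator {u : ℂ → ℝ} (hu : CircleIntegrable u 0 1) {N : Set ℂ}
    (hN : MeasurableSet N) : CircleIntegrable (N.indicator u) 0 1 := by
  rw [circleIntegrable_iff_integrableOn_Ioc 0] at hu ⊢
  exact Integrable.indicator hu ((continuous_circleMap 0 1).measurable hN)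

/-- If `1/G ∈ L^s` on the arc, then `exp (-s u)`, replaced by `1` off a piece `N` of the arc, is
integrable on the circle. -/
lemma circleIntegrable_exp_indicator {G : ℂ → ℂ} {u : ℂ → ℝ} {a b s : ℝ} {N : Set ℂ}
    (hu : CircleIntegrable u 0 1) (hs : 0 < s) (hba : b ≤ a + 2 * Real.pi)
    (hGu : ∀ᵐ t ∂volume.restrict (Ioc a (a + 2 * Real.pi)),
      ‖G (circleMap 0 1 t)‖ = Real.exp (u (circleMap 0 1 t)))
    (hN : MeasurableSet N) (hNarc : N ∩ sphere 0 1 ⊆ closedArc a b)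
    (hmem : MemLp (fun t : ℝ => 1 / G (circleMap 0 1 t)) (ENNReal.ofReal s)
      (volume.restrict (Icc a b))) :
    CircleIntegrable (fun ζ => Real.exp (N.indicator (fun ζ => -s * u ζ) ζ)) 0 1 := by
  have hv : CircleIntegrable (N.indicator (fun ζ => -s * u ζ)) 0 1 :=
    (hu.real_const_mul (-s)).indicator hN
  rw [circleIntegrable_iff_integrableOn_Ioc a] at hv ⊢
  have hint : IntegrableOn (fun t : ℝ => ‖1 / G (circleMap 0 1 t)‖ ^ s) (Icc a b) := by
    have := hmem.integrable_norm_rpow (by simpa using hs) ENNReal.ofReal_ne_top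
    rwa [ENNReal.toReal_ofReal hs.le] at this
  have hdom : IntegrableOn (fun t => 1 + (Icc a b).indicator
      (fun t : ℝ => ‖1 / G (circleMap 0 1 t)‖ ^ s) t) (Ioc a (a + 2 * Real.pi)) := by
    refine Integrable.add (integrable_const _) ?_
    exact ((integrable_indicator_iff measurableSet_Icc).2 hint).integrableOn
  refine Integrable.mono' hdom
    (Real.measurable_exp.comp_aemeasurable hv.aemeasurable).aestronglyMeasurable ?_
  -- if `b = a + 2π`, both end parameters give the same point, so the last one is discarded
  have hne : ∀ᵐ t ∂volume.restrict (Ioc a (a + 2 * Real.pi)), t ≠ a + 2 * Real.pi :=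
    ae_restrict_of_ae (Measure.ae_ne volume _)
  filter_upwards [hGu, hne, ae_restrict_mem measurableSet_Ioc] with t h1 h2 h3
  rw [Real.norm_eq_abs, abs_of_pos (Real.exp_pos _)]
  have hnn : 0 ≤ (Icc a b).indicator (fun t : ℝ => ‖1 / G (circleMap 0 1 t)‖ ^ s) t :=
    indicator_nonneg (fun _ _ => by positivity) _
  by_cases htN : circleMap 0 1 t ∈ N
  · obtain ⟨t', ht', heq⟩ := hNarc ⟨htN, circleMap_mem_sphere 0 zero_le_one t⟩
    have htt : t' = t := by
      refine eq_of_circleMap_eq one_ne_zero ?_ heq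
      have := lt_of_le_of_ne h3.2 h2
      rw [abs_lt]
      constructor <;> linarith [ht'.1, ht'.2, h3.1]
    rw [htt] at ht'
    rw [indicator_of_mem htN, indicator_of_mem ht', norm_div, norm_one, h1, one_div,
      ← Real.exp_neg, ← Real.exp_mul]
    have : -u (circleMap 0 1 t) * s = -s * u (circleMap 0 1 t) := by ring
    rw [this]
    linarith
  · rw [indicator_of_notMem htN, Real.exp_zero]
    linarith

/-- Near a point where `exp (-s u)` is integrable, the power `|g|^{-s} = exp P[-s u]` is dominated
by a Poisson integral: the far part of `u` contributes a bounded amount to the exponent, and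
Jensen's inequality handles the near part. -/
lemma exists_rpow_neg_le_poissonIntegral {g : ℂ → ℂ} {u : ℂ → ℝ} {s δ : ℝ} {ζ₀ : ℂ}
    (hu : CircleIntegrable u 0 1)
    (hgu : ∀ z ∈ ball (0 : ℂ) 1, ‖g z‖ = Real.exp (poissonIntegral u z)) (hδ : 0 < δ)
    (hw : CircleIntegrable
      (fun ζ => Real.exp ((ball ζ₀ δ).indicator (fun ζ => -s * u ζ) ζ)) 0 1) :
    ∃ w : ℂ → ℝ, CircleIntegrable w 0 1 ∧ (∀ ζ, 0 ≤ w ζ) ∧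
      ∀ z ∈ ball (0 : ℂ) 1, dist z ζ₀ ≤ δ / 2 → ‖g z‖ ^ (-s) ≤ poissonIntegral w z := by
  set v := (ball ζ₀ δ).indicator (fun ζ => -s * u ζ) with hv
  have hvi : CircleIntegrable v 0 1 := (hu.real_const_mul (-s)).indicator measurableSet_ball
  set v' := (ball ζ₀ δ)ᶜ.indicator (fun ζ => -s * u ζ) with hv'
  have hvi' : CircleIntegrable v' 0 1 :=
    (hu.real_const_mul (-s)).indicator measurableSet_ball.compl
  set C := 4 / δ ^ 2 * Real.circleAverage (fun ζ => |v' ζ|) 0 1 with hC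
  refine ⟨fun ζ => Real.exp C * Real.exp (v ζ), hw.real_const_mul _, fun ζ => by positivity,
    fun z hz hd => ?_⟩
  have h1 : -s * poissonIntegral u z = poissonIntegral v z + poissonIntegral v' z := by
    rw [← poissonIntegral_add hvi hvi' hz, ← poissonIntegral_const_mul]
    congr 1
    ext ζ
    exact (congrFun (indicator_self_add_compl (ball ζ₀ δ) (fun ζ => -s * u ζ)) ζ).symm
  have h2 : poissonIntegral v' z ≤ C := by
    refine (le_abs_self _).trans ((abs_poissonIntegral_le hvi' hz).trans ?_)
    rw [hC, ← smul_eq_mul, ← Real.circleAverage_fun_smul]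
    apply Real.circleAverage_mono (hvi'.abs.poissonKernel_mul hz) (hvi'.abs.real_const_mul _)
    intro ζ hζ
    rw [abs_one] at hζ
    simp only [Pi.abs_apply]
    by_cases hζN : ζ ∈ ball ζ₀ δ
    · simp [hv', hζN]
    · refine mul_le_mul_of_nonneg_right ?_ (abs_nonneg _)
      refine (poissonKernel_zero_le_of_dist hδ hz hζ (by simpa using hζN) hd).trans ?_
      gcongr
      nlinarith [sq_nonneg ‖z‖]
  rw [hgu z hz, ← Real.exp_mul, mul_comm, h1, poissonIntegral_const_mul, Real.exp_add, mul_comm]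
  gcongr
  exact exp_poissonIntegral_le hvi hw hz

/-- Young's inequality in the form used for `|f|^ρ = (|f g| · |g|⁻¹)^ρ`. -/
lemma rpow_le_add_of_inv_add_inv {p s ρ x y : ℝ} (hp : 0 < p) (hs : 0 < s) (hρ : 0 < ρ)
    (h : 1 / ρ = 1 / p + 1 / s) (hx : 0 ≤ x) (hy : 0 < y) :
    x ^ ρ ≤ x ^ p * y ^ p + y ^ (-s) := by
  have hconj : (p / ρ).HolderConjugate (s / ρ) := by
    rw [Real.holderConjugate_iff]
    have h2 : (p / ρ)⁻¹ + (s / ρ)⁻¹ = 1 := by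
      have : (p / ρ)⁻¹ + (s / ρ)⁻¹ = ρ * (1 / p + 1 / s) := by field_simp
      rw [this, ← h]; field_simp
    refine ⟨?_, h2⟩
    rw [one_lt_div hρ]
    have : 1 / p < 1 / ρ := by rw [h]; linarith [show 0 < 1 / s by positivity]
    exact (one_div_lt_one_div hp hρ).1 this
  have hY := Real.young_inequality_of_nonneg (a := (x * y) ^ ρ) (b := y ^ (-ρ))
    (by positivity) (by positivity) hconj
  have e1 : (x * y) ^ ρ * y ^ (-ρ) = x ^ ρ := by
    rw [Real.mul_rpow hx hy.le, mul_assoc, ← Real.rpow_add hy]; simp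
  have e2 : ((x * y) ^ ρ) ^ (p / ρ) = x ^ p * y ^ p := by
    rw [← Real.rpow_mul (by positivity), mul_div_cancel₀ _ hρ.ne', Real.mul_rpow hx hy.le]
  have e3 : (y ^ (-ρ)) ^ (s / ρ) = y ^ (-s) := by
    rw [← Real.rpow_mul hy.le]; congr 1; field_simp
  rw [e1, e2, e3] at hY
  refine hY.trans (add_le_add (div_le_self (by positivity) hconj.lt.le)
    (div_le_self (by positivity) hconj.symm.lt.le))

/-- `‖f‖ ^ ρ` is dominated, in the part of the unit disk lying in `N`, by a continuous nonnegative
function on the disk whose means over the circles `|z| = r` are bounded. This localizes to `N` the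
condition defining the Hardy space `H^ρ`. -/
def HasHardyMajorantOn (f : ℂ → ℂ) (ρ : ℝ) (N : Set ℂ) : Prop :=
  ∃ (M : ℂ → ℝ) (B : ℝ), ContinuousOn M (ball 0 1) ∧ (∀ z ∈ ball (0 : ℂ) 1, 0 ≤ M z) ∧
    (∀ r ∈ Ioo (0 : ℝ) 1, Real.circleAverage M 0 r ≤ B) ∧
    ∀ z ∈ ball (0 : ℂ) 1 ∩ N, ‖f z‖ ^ ρ ≤ M z

lemma HasHardyMajorantOn.of_norm_le {f h : ℂ → ℂ} {ρ C : ℝ} {N N' : Set ℂ} (hρ : 0 < ρ)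
    (hC : 0 ≤ C) (hf : HasHardyMajorantOn f ρ N) (hN : N' ⊆ N)
    (hle : ∀ z ∈ ball (0 : ℂ) 1 ∩ N', ‖h z‖ ≤ C * ‖f z‖) : HasHardyMajorantOn h ρ N' := by
  obtain ⟨M, B, hMc, hM0, hMB, hM⟩ := hf
  refine ⟨fun z => C ^ ρ * M z, C ^ ρ * B, hMc.const_mul _, fun z hz => ?_, fun r hr => ?_,
    fun z hz => ?_⟩
  · have := hM0 z hz
    positivity
  · simp only [← smul_eq_mul]
    rw [Real.circleAverage_fun_smul]
    simp only [smul_eq_mul]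
    have := hMB r hr
    gcongr
  · calc ‖h z‖ ^ ρ ≤ (C * ‖f z‖) ^ ρ := Real.rpow_le_rpow (norm_nonneg _) (hle z hz) hρ.le
      _ = C ^ ρ * ‖f z‖ ^ ρ := Real.mul_rpow hC (norm_nonneg _)
      _ ≤ C ^ ρ * M z := by
        have := hM z ⟨hz.1, hN hz.2⟩
        gcongr

/-- A function in the weighted space is, near a point where `exp (-s u)` is integrable, locally
in `H^ρ`, by Young's inequality. -/
lemma hasHardyMajorantOn_of_mem_weightedHardySpace {f g : ℂ → ℂ} {u : ℂ → ℝ} {p s ρ δ : ℝ} {ζ₀ : ℂ}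
    (hp : 0 < p) (hs : 0 < s) (hρ : 0 < ρ) (h : 1 / ρ = 1 / p + 1 / s)
    (hu : CircleIntegrable u 0 1)
    (hgu : ∀ z ∈ ball (0 : ℂ) 1, ‖g z‖ = Real.exp (poissonIntegral u z)) (hδ : 0 < δ)
    (hw : CircleIntegrable
      (fun ζ => Real.exp ((ball ζ₀ δ).indicator (fun ζ => -s * u ζ) ζ)) 0 1)
    (hf : f ∈ WeightedHardySpace p g) :
    HasHardyMajorantOn f ρ (closedBall ζ₀ (δ / 2)) := by
  obtain ⟨w, hwi, hw0, hwle⟩ := exists_rpow_neg_le_poissonIntegral hu hgu hδ hw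
  obtain ⟨hfd, B, hB⟩ := hf
  have hgc : ContinuousOn (fun z => ‖g z‖) (ball 0 1) :=
    (Real.continuous_exp.comp_continuousOn (continuousOn_poissonIntegral hu)).congr hgu
  have hc1 : ContinuousOn (fun z => ‖f z‖ ^ p * ‖g z‖ ^ p) (ball 0 1) :=
    (hfd.continuousOn.norm.rpow_const fun _ _ => Or.inr hp.le).mul
      (hgc.rpow_const fun _ _ => Or.inr hp.le)
  refine ⟨fun z => ‖f z‖ ^ p * ‖g z‖ ^ p + poissonIntegral w z, B + Real.circleAverage w 0 1,
    hc1.add (continuousOn_poissonIntegral hwi), fun z hz => ?_, fun r hr => ?_,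
    fun z ⟨hz, hd⟩ => ?_⟩
  · have := poissonIntegral_mono (circleIntegrable_const 0 0 1) hwi (fun ζ _ => hw0 ζ) hz
    rw [poissonIntegral_const _ hz] at this
    positivity
  · rw [Real.circleAverage_fun_add _ (circleIntegrable_poissonIntegral hwi hr),
      circleAverage_poissonIntegral hwi hr]
    · gcongr
      exact hB ⟨r, hr, rfl⟩
    · exact (hc1.mono (sphere_subset_ball hr.2)).circleIntegrable hr.1.le
  · have hg0 : 0 < ‖g z‖ := by rw [hgu z hz]; exact Real.exp_pos _
    exact (rpow_le_add_of_inv_add_inv hp hs hρ h (norm_nonneg _) hg0).trans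
      (add_le_add le_rfl (hwle z hz hd))

/-! ### Primitives up to the boundary -/

/-- On a finite measure space, an almost everywhere convergent sequence that is bounded in `L^ρ`
for some `ρ > 1` converges in `L¹`. -/
lemma tendsto_eLpNorm_one_of_ae_of_bounded {X : Type*} [MeasurableSpace X] {μ : Measure X}
    [IsFiniteMeasure μ] {f : ℕ → X → ℂ} {L : X → ℂ} {ρ : ℝ} {B : ℝ≥0∞} (hρ : 1 < ρ) (hB : B ≠ ⊤)
    (hf : ∀ n, AEStronglyMeasurable (f n) μ) (hfB : ∀ n, eLpNorm (f n) (ENNReal.ofReal ρ) μ ≤ B)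
    (hL : ∀ᵐ x ∂μ, Tendsto (fun n => f n x) atTop (𝓝 (L x))) :
    Integrable L μ ∧ Tendsto (fun n => eLpNorm (f n - L) 1 μ) atTop (𝓝 0) := by
  have hρ1 : (1 : ℝ≥0∞) ≤ ENNReal.ofReal ρ := by simpa using hρ.le
  have hLm : AEStronglyMeasurable L μ := aestronglyMeasurable_of_tendsto_ae atTop hf hL
  have hLρ : MemLp L (ENNReal.ofReal ρ) μ :=
    ⟨hLm, (Lp.eLpNorm_le_of_ae_tendsto (Eventually.of_forall hfB) hf hL).trans_lt hB.lt_top⟩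
  have hL1 : MemLp L 1 μ := hLρ.mono_exponent hρ1
  refine ⟨memLp_one_iff_integrable.1 hL1, ?_⟩
  refine tendsto_Lp_finite_of_tendsto_ae le_rfl ENNReal.one_ne_top hf hL1 ?_ hL
  intro ε hε
  set κ : ℝ := 1 - 1 / ρ with hκ
  have hκ0 : 0 < κ := by
    have : 1 / ρ < 1 := by rw [div_lt_one (by linarith)]; exact hρ
    linarith
  set b := B.toReal + 1 with hb
  have hb0 : 0 < b := by positivity
  have hBb : B ≤ ENNReal.ofReal b := by
    rw [← ENNReal.ofReal_toReal hB]
    exact ENNReal.ofReal_le_ofReal (by simp [hb])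
  -- by Hölder, `∫ₛ |fₙ| ≤ b * μ(s) ^ κ`
  refine ⟨(ε / b) ^ (1 / κ), by positivity, fun n s hs hμs => ?_⟩
  rw [eLpNorm_indicator_eq_eLpNorm_restrict hs]
  refine (eLpNorm_le_eLpNorm_mul_rpow_measure_univ hρ1 (hf n).restrict).trans ?_
  have hexp : 1 / (1 : ℝ≥0∞).toReal - 1 / (ENNReal.ofReal ρ).toReal = κ := by
    rw [ENNReal.toReal_ofReal (by linarith)]; simp [hκ]
  rw [hexp, Measure.restrict_apply_univ]
  calc eLpNorm (f n) (ENNReal.ofReal ρ) (μ.restrict s) * μ s ^ κ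
      ≤ ENNReal.ofReal b * ENNReal.ofReal ((ε / b) ^ (1 / κ)) ^ κ := by
        gcongr
        exact (eLpNorm_mono_measure _ Measure.restrict_le_self).trans ((hfB n).trans hBb)
    _ = ENNReal.ofReal ε := by
        rw [ENNReal.ofReal_rpow_of_nonneg (by positivity) hκ0.le, ← ENNReal.ofReal_mul hb0.le,
          ← Real.rpow_mul (by positivity), one_div_mul_cancel hκ0.ne', Real.rpow_one,
          mul_div_cancel₀ _ hb0.ne']

open Complex in
/-- A holomorphic function on a rectangle above the real axis, with horizontal means bounded in
`L^ρ`, `ρ > 1`, and with vertical limits `L` almost everywhere, has a primitive that extends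
continuously to the real axis, where it is a primitive of `L`. -/
lemma exists_primitive_continuousOn_boundary {F : ℂ → ℂ} {L : ℝ → ℂ} {α β η ρ : ℝ} {B : ℝ≥0∞}
    (hαβ : α < β) (hη : 0 < η) (hρ : 1 < ρ) (hB : B ≠ ⊤)
    (hF : DifferentiableOn ℂ F (Ioo α β ×ℂ Ioo 0 η))
    (hFB : ∀ y ∈ Ioo 0 η, eLpNorm (fun x : ℝ => F (x + y * I)) (ENNReal.ofReal ρ)
      (volume.restrict (Ioo α β)) ≤ B)
    (hL : ∀ᵐ x : ℝ ∂volume.restrict (Ioo α β),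
      Tendsto (fun y : ℝ => F (x + y * I)) (𝓝[>] 0) (𝓝 (L x))) :
    ∃ A : ℂ → ℂ, ContinuousOn A (Ioo α β ×ℂ Ico 0 η) ∧
      (∀ w ∈ Ioo α β ×ℂ Ioo 0 η, HasDerivAt A (F w) w) ∧
      ∀ x ∈ Ioo α β, ∀ x' ∈ Ioo α β, A x' - A x = ∫ t in x..x', L t := by
  set μ := volume.restrict (Ioo α β) with hμ
  set R : Set ℂ := Ioo α β ×ℂ Ioo 0 η with hR
  have hRo : IsOpen R := isOpen_Ioo.reProdIm isOpen_Ioo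
  have hmemR : ∀ {x y : ℝ}, x ∈ Ioo α β → y ∈ Ioo 0 η → (x + y * I : ℂ) ∈ R := by
    intro x y hx hy
    rw [hR, mem_reProdIm]
    simpa using ⟨hx, hy⟩
  have hrowc : ∀ y ∈ Ioo 0 η, ContinuousOn (fun x : ℝ => F (x + y * I)) (Ioo α β) := fun y hy =>
    hF.continuousOn.comp (by fun_prop) fun x hx => hmemR hx hy
  have hrowm : ∀ y ∈ Ioo 0 η, AEStronglyMeasurable (fun x : ℝ => F (x + y * I)) μ := fun y hy =>
    (hrowc y hy).aestronglyMeasurable measurableSet_Ioo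
  have hρ1 : (1 : ℝ≥0∞) ≤ ENNReal.ofReal ρ := by simpa using hρ.le
  have hrowi : ∀ y ∈ Ioo 0 η, Integrable (fun x : ℝ => F (x + y * I)) μ := fun y hy =>
    memLp_one_iff_integrable.1
      (MemLp.mono_exponent ⟨hrowm y hy, (hFB y hy).trans_lt hB.lt_top⟩ hρ1)
  have hevη : ∀ᶠ y : ℝ in 𝓝[>] 0, y ∈ Ioo 0 η := Ioo_mem_nhdsGT hη
  -- the rows converge in the mean to `L`
  have hconv : ∀ y : ℕ → ℝ, Tendsto y atTop (𝓝[>] 0) → (∀ n, y n ∈ Ioo 0 η) →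
      Integrable L μ ∧
        Tendsto (fun n => eLpNorm ((fun x : ℝ => F (x + y n * I)) - L) 1 μ) atTop (𝓝 0) := by
    intro y hy hyη
    refine tendsto_eLpNorm_one_of_ae_of_bounded hρ hB (fun n => hrowm _ (hyη n))
      (fun n => hFB _ (hyη n)) ?_
    filter_upwards [hL] with x hx using hx.comp hy
  have hLi : Integrable L μ := by
    obtain ⟨y, -, hy, hylim⟩ := exists_seq_strictAnti_tendsto' hη
    exact (hconv y (tendsto_nhdsWithin_iff.2 ⟨hylim, Eventually.of_forall fun n => (hy n).1⟩) hy).1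
  set e : ℝ → ℝ := fun y => ∫ x, ‖F (x + y * I) - L x‖ ∂μ with he
  have he0 : Tendsto e (𝓝[>] 0) (𝓝 0) := by
    refine tendsto_of_seq_tendsto fun y hy => ?_
    obtain ⟨N, hN⟩ := eventually_atTop.1 (hy.eventually hevη)
    rw [← tendsto_add_atTop_iff_nat N]
    have := (hconv (fun n => y (n + N)) ((tendsto_add_atTop_iff_nat N).2 hy)
      fun n => hN _ (by omega)).2
    have h2 := (ENNReal.tendsto_toReal ENNReal.zero_ne_top).comp this
    refine h2.congr fun n => ?_
    rw [Function.comp_apply, eLpNorm_one_eq_lintegral_enorm,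
      ← ofReal_integral_norm_eq_lintegral_enorm ((hrowi _ (hN _ (by omega))).sub hLi),
      ENNReal.toReal_ofReal (integral_nonneg fun _ => norm_nonneg _)]
    rfl
  -- a vertical segment on which `F` is integrable
  obtain ⟨x₀, hx₀, hcol⟩ : ∃ x₀ ∈ Ioo α β, ∫⁻ y in Ioo 0 η, ‖F (x₀ + y * I)‖ₑ < ⊤ := by
    have hm : AEMeasurable (Function.uncurry fun x y : ℝ => ‖F (x + y * I)‖ₑ)
        (μ.prod (volume.restrict (Ioo 0 η))) := by
      rw [hμ, Measure.prod_restrict]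
      have : ContinuousOn (fun q : ℝ × ℝ => F (q.1 + q.2 * I)) (Ioo α β ×ˢ Ioo 0 η) :=
        hF.continuousOn.comp (by fun_prop) fun q hq => hmemR hq.1 hq.2
      exact (this.aestronglyMeasurable (measurableSet_Ioo.prod measurableSet_Ioo)).enorm
    have hfin : ∫⁻ x : ℝ, (∫⁻ y in Ioo 0 η, ‖F (x + y * I)‖ₑ) ∂μ ≠ ⊤ := by
      rw [lintegral_lintegral_swap hm]
      set B' := B * μ univ ^ (1 / (1 : ℝ≥0∞).toReal - 1 / (ENNReal.ofReal ρ).toReal) with hB'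
      have hB't : B' ≠ ⊤ := by
        refine ENNReal.mul_ne_top hB (ENNReal.rpow_ne_top_of_nonneg ?_ (measure_ne_top _ _))
        rw [ENNReal.toReal_ofReal (by linarith)]
        have : 1 / ρ < 1 := by rw [div_lt_one (by linarith)]; exact hρ
        simp only [ENNReal.toReal_one, div_one]
        linarith
      have hle : ∫⁻ y in Ioo 0 η, (∫⁻ x : ℝ, ‖F (x + y * I)‖ₑ ∂μ) ≤ ∫⁻ _ in Ioo 0 η, B' := by
        refine setLIntegral_mono measurable_const fun y hy => ?_
        rw [← eLpNorm_one_eq_lintegral_enorm]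
        refine (eLpNorm_le_eLpNorm_mul_rpow_measure_univ hρ1 (hrowm y hy)).trans ?_
        exact mul_le_mul' (hFB y hy) le_rfl
      refine ne_top_of_le_ne_top ?_ hle
      rw [setLIntegral_const]
      exact ENNReal.mul_ne_top hB't (by simp)
    have hae := ae_lt_top' hm.lintegral_prod_right' hfin
    have hne : (ae μ).NeBot := by
      rw [hμ, ae_restrict_neBot]
      simpa using hαβ
    obtain ⟨x₀, h1, h2⟩ := (hae.and (ae_restrict_mem measurableSet_Ioo)).exists
    exact ⟨x₀, h2, h1⟩
  -- a primitive in the open rectangle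
  have hconvR : Convex ℝ R := 
    ((convex_Ioo α β).linear_preimage reLm).inter ((convex_Ioo 0 η).linear_preimage imLm)
  obtain ⟨A₀, hA₀⟩ := hconvR.exists_forall_hasDerivWithinAt hF
  have hA₀' : ∀ w ∈ R, HasDerivAt A₀ (F w) w := fun w hw =>
    (hA₀ w hw).hasDerivAt (hRo.mem_nhds hw)
  have hrowFTC : ∀ y ∈ Ioo 0 η, ∀ x ∈ Ioo α β,
      A₀ (x + y * I) - A₀ (x₀ + y * I) = ∫ t in x₀..x, F (t + y * I) := by
    intro y hy x hx
    have hsub : uIcc x₀ x ⊆ Ioo α β := ordConnected_Ioo.uIcc_subset hx₀ hx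
    refine (intervalIntegral.integral_eq_sub_of_hasDerivAt
      (f := fun t : ℝ => A₀ (t + y * I)) (fun t ht => ?_) ?_).symm
    · have h1 : HasDerivAt (fun t : ℝ => (t + y * I : ℂ)) 1 t :=
        (hasDerivAt_id t).ofReal_comp.add_const _
      simpa [Function.comp_def] using (hA₀' _ (hmemR (hsub ht) hy)).comp t h1
    · exact ((hrowc y hy).mono hsub).intervalIntegrable
  obtain ⟨c, hc⟩ : ∃ c, Tendsto (fun y : ℝ => A₀ (x₀ + y * I)) (𝓝[>] 0) (𝓝 c) := by
    have hcolc : ContinuousOn (fun y : ℝ => F (x₀ + y * I)) (Ioo 0 η) :=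
      hF.continuousOn.comp (by fun_prop) fun y hy => hmemR hx₀ hy
    have hcoli : IntegrableOn (fun y : ℝ => F (x₀ + y * I)) (Ioo 0 η) :=
      ⟨hcolc.aestronglyMeasurable measurableSet_Ioo, hcol⟩
    have hη2 : η / 2 ∈ Ioo 0 η := ⟨by linarith, by linarith⟩
    have hcoli' : IntegrableOn (fun y : ℝ => F (x₀ + y * I) * I) (uIcc 0 (η / 2)) := by
      rw [uIcc_of_le hη2.1.le, integrableOn_Icc_iff_integrableOn_Ioc]
      exact (hcoli.mono_set fun y hy => ⟨hy.1, hy.2.trans_lt hη2.2⟩).mul_const I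
    have hcont := intervalIntegral.continuousOn_primitive_interval_left hcoli'
    have hlim := (hcont 0 left_mem_uIcc).tendsto
    refine ⟨A₀ (x₀ + (η / 2 : ℝ) * I) - ∫ y in (0 : ℝ)..η / 2, F (x₀ + y * I) * I, ?_⟩
    have hlim2 : Tendsto (fun y => ∫ t in y..η / 2, F (x₀ + t * I) * I) (𝓝[>] 0)
        (𝓝 (∫ y in (0 : ℝ)..η / 2, F (x₀ + y * I) * I)) := by
      refine hlim.mono_left ?_
      rw [uIcc_of_le hη2.1.le]
      refine nhdsWithin_le_of_mem ?_
      exact mem_of_superset (Ioo_mem_nhdsGT hη2.1) Ioo_subset_Icc_self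
    refine (hlim2.const_sub _).congr' ?_
    filter_upwards [Ioo_mem_nhdsGT hη2.1] with y hy
    have hsub : uIcc y (η / 2) ⊆ Ioo 0 η :=
      ordConnected_Ioo.uIcc_subset ⟨hy.1, hy.2.trans hη2.2⟩ hη2
    have hFTC : ∫ t in y..η / 2, F (x₀ + t * I) * I =
        A₀ (x₀ + (η / 2 : ℝ) * I) - A₀ (x₀ + y * I) := by
      refine intervalIntegral.integral_eq_sub_of_hasDerivAt
        (f := fun t : ℝ => A₀ (x₀ + t * I)) (fun t ht => ?_) ?_
      · have h1 : HasDerivAt (fun t : ℝ => (x₀ + t * I : ℂ)) I t := by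
          simpa using ((hasDerivAt_id t).ofReal_comp.mul_const I).const_add (x₀ : ℂ)
        exact (hA₀' _ (hmemR hx₀ (hsub ht))).comp t h1
      · exact ((hcolc.mono hsub).mul continuousOn_const).intervalIntegrable
    rw [hFTC]
    ring
  have hLint : ∀ x ∈ Ioo α β, ∀ x' ∈ Ioo α β, IntervalIntegrable L volume x x' := by
    intro x hx x' hx'
    rw [intervalIntegrable_iff]
    exact IntegrableOn.mono_set hLi
      (uIoc_subset_uIcc.trans (ordConnected_Ioo.uIcc_subset hx hx'))
  set J : ℝ → ℂ := fun x => c + ∫ t in x₀..x, L t with hJ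
  set A : ℂ → ℂ := fun w => if 0 < w.im then A₀ w else J w.re with hA
  have hJc : ContinuousOn J (Ioo α β) := by
    intro x hx
    have hx' : ∃ x₁ x₂, α < x₁ ∧ x₁ < x ∧ x₁ < x₀ ∧ x < x₂ ∧ x₀ < x₂ ∧ x₂ < β := by
      obtain ⟨x₁, h1, h2⟩ := exists_between (lt_min hx.1 hx₀.1)
      obtain ⟨x₂, h3, h4⟩ := exists_between (max_lt hx.2 hx₀.2)
      exact ⟨x₁, x₂, h1, h2.trans_le (min_le_left _ _), h2.trans_le (min_le_right _ _),
        (le_max_left _ _).trans_lt h3, (le_max_right _ _).trans_lt h3, h4⟩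
    obtain ⟨x₁, x₂, h1, h2, h3, h4, h5, h6⟩ := hx'
    have h12 : x₁ ≤ x₂ := (h2.trans h4).le
    have hi : IntegrableOn L (uIcc x₁ x₂) := by
      rw [uIcc_of_le h12]
      exact IntegrableOn.mono_set hLi fun t ht => ⟨h1.trans_le ht.1, ht.2.trans_lt h6⟩
    have := intervalIntegral.continuousOn_primitive_interval'
      (μ := volume) (f := L) (a := x₀) (b₁ := x₁) (b₂ := x₂)
      ((intervalIntegrable_iff_integrableOn_Icc_of_le h12).2 (by rwa [uIcc_of_le h12] at hi))
      (by rw [uIcc_of_le h12]; exact ⟨h3.le, h5.le⟩)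
    have h7 : ContinuousAt (fun x => ∫ t in x₀..x, L t) x :=
      this.continuousAt (by rw [uIcc_of_le h12]; exact Icc_mem_nhds h2 h4)
    exact (continuousAt_const.add h7).continuousWithinAt
  -- `d y` bounds the distance from the primitive at height `y` to its boundary values, uniformly in
  -- the horizontal coordinate
  set d : ℝ → ℝ := fun y => if 0 < y then ‖A₀ (x₀ + y * I) - c‖ + e y else 0 with hd
  have hd0 : Tendsto d (𝓝[≥] 0) (𝓝 0) := by
    rw [← Ioi_insert, nhdsWithin_insert, tendsto_sup]
    constructor
    · rw [tendsto_pure_left]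
      intro s hs
      simpa [hd] using mem_of_mem_nhds hs
    · have h1 : Tendsto (fun y : ℝ => ‖A₀ (x₀ + y * I) - c‖ + e y) (𝓝[>] 0) (𝓝 0) := by
        simpa using (hc.sub_const c).norm.add he0
      refine h1.congr' ?_
      filter_upwards [self_mem_nhdsWithin] with y hy
      exact (if_pos hy).symm
  have hAJ : ∀ w ∈ Ioo α β ×ℂ Ico 0 η, ‖A w - J w.re‖ ≤ d w.im := by
    intro w hw
    rw [mem_reProdIm] at hw
    by_cases him : 0 < w.im
    · have hy : w.im ∈ Ioo 0 η := ⟨him, hw.2.2⟩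
      have h1 := hrowFTC w.im hy w.re hw.1
      rw [re_add_im] at h1
      have hsub : uIoc x₀ w.re ⊆ Ioo α β :=
        uIoc_subset_uIcc.trans (ordConnected_Ioo.uIcc_subset hx₀ hw.1)
      have hi1 : IntervalIntegrable (fun t : ℝ => F (t + w.im * I)) volume x₀ w.re := by
        rw [intervalIntegrable_iff]
        exact IntegrableOn.mono_set (hrowi _ hy) hsub
      have h2 : A w - J w.re = (A₀ (x₀ + w.im * I) - c) +
          ∫ t in x₀..w.re, (F (t + w.im * I) - L t) := by
        rw [intervalIntegral.integral_sub hi1 (hLint _ hx₀ _ hw.1), ← h1]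
        simp only [hA, hJ, if_pos him]
        ring
      simp only [hd, if_pos him]
      rw [h2]
      refine (norm_add_le _ _).trans (add_le_add le_rfl ?_)
      refine intervalIntegral.norm_integral_le_integral_norm_uIoc.trans ?_
      exact setIntegral_mono_set ((hrowi _ hy).sub hLi).norm
        (Eventually.of_forall fun _ => norm_nonneg _) hsub.eventuallyLE
    · simp [hA, hd, him]
  refine ⟨A, ?_, ?_, ?_⟩
  · intro w hw
    have hw' := hw
    rw [mem_reProdIm] at hw'
    by_cases him : 0 < w.im
    · have hwR : w ∈ R := ⟨hw'.1, him, hw'.2.2⟩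
      refine ContinuousAt.continuousWithinAt ?_
      refine (hA₀' w hwR).continuousAt.congr ?_
      filter_upwards [hRo.mem_nhds hwR] with z hz
      exact (if_pos hz.2.1).symm
    · have him0 : w.im = 0 := le_antisymm (not_lt.1 him) hw'.2.1
      have hJt : Tendsto (fun z : ℂ => J z.re) (𝓝[Ioo α β ×ℂ Ico 0 η] w) (𝓝 (J w.re)) := by
        have h1 : Tendsto J (𝓝 w.re) (𝓝 (J w.re)) :=
          (hJc.continuousAt (isOpen_Ioo.mem_nhds hw'.1))
        exact h1.comp (continuous_re.continuousAt.tendsto.mono_left nhdsWithin_le_nhds)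
      have hdt : Tendsto (fun z : ℂ => d z.im) (𝓝[Ioo α β ×ℂ Ico 0 η] w) (𝓝 0) := by
        refine hd0.comp (tendsto_nhdsWithin_iff.2 ⟨?_, ?_⟩)
        · rw [← him0]
          exact continuous_im.continuousAt.tendsto.mono_left nhdsWithin_le_nhds
        · filter_upwards [self_mem_nhdsWithin] with z hz using hz.2.1
      have hdiff : Tendsto (fun z => A z - J z.re) (𝓝[Ioo α β ×ℂ Ico 0 η] w) (𝓝 0) := by
        refine squeeze_zero_norm' ?_ hdt
        filter_upwards [self_mem_nhdsWithin] with z hz using hAJ z hz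
      have := hdiff.add hJt
      simp only [sub_add_cancel, zero_add] at this
      have hAw : A w = J w.re := if_neg him
      rw [ContinuousWithinAt, hAw]
      exact this
  · intro w hw
    refine (hA₀' w hw).congr_of_eventuallyEq ?_
    filter_upwards [hRo.mem_nhds hw] with z hz
    exact if_pos hz.2.1
  · intro x hx x' hx'
    simp only [hA, hJ, ofReal_im, lt_irrefl, if_false, ofReal_re]
    rw [add_sub_add_left_eq_sub, intervalIntegral.integral_interval_sub_left
      (hLint _ hx₀ _ hx') (hLint _ hx₀ _ hx)]

/-! ### Reflection across the real axis -/

open Complex in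
/-- Painlevé's theorem: a continuous function on a disk centred on the real axis that is holomorphic
off the real axis is holomorphic. By Morera's theorem it is enough to integrate over rectangles,
and the real axis cuts a rectangle into two to which the Cauchy–Goursat theorem applies. -/
lemma differentiableOn_ball_of_differentiableAt_off_real {E : ℂ → ℂ} {c : ℂ} {r : ℝ}
    (hc : c.im = 0) (hE : ContinuousOn E (ball c r))
    (hd : ∀ w ∈ ball c r, w.im ≠ 0 → DifferentiableAt ℂ E w) :
    DifferentiableOn ℂ E (ball c r) := by
  have hproj : ∀ p ∈ ball c r, ((p.re : ℝ) : ℂ) ∈ ball c r := by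
    intro p hp
    rw [mem_ball, dist_eq_norm] at hp ⊢
    have : ((p.re : ℝ) : ℂ) - c = (((p - c).re : ℝ) : ℂ) := by
      apply Complex.ext <;> simp [hc]
    rw [this, norm_real]
    exact (abs_re_le_norm _).trans_lt hp
  refine (IsConservativeOn.isExactOn_ball hE ?_).differentiableOn isOpen_ball
  intro z w hzw
  have hz : z ∈ ball c r := hzw (by simp [Rectangle, mem_reProdIm])
  have hw : w ∈ ball c r := hzw (by simp [Rectangle, mem_reProdIm])
  have hzw' : (z.re + w.im * I : ℂ) ∈ ball c r := hzw (by simp [Rectangle, mem_reProdIm])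
  have hwz' : (w.re + z.im * I : ℂ) ∈ ball c r := hzw (by simp [Rectangle, mem_reProdIm])
  have hz0 := hproj z hz
  have hw0 := hproj w hw
  have hR1 : uIcc z.re w.re ×ℂ uIcc z.im 0 ⊆ ball c r := by
    have := (convex_ball c r).rectangle_subset (z := z) (w := (w.re : ℂ)) hz hw0
      (by simpa using hz0) (by simpa using hwz')
    simpa [Rectangle] using this
  have hR2 : uIcc z.re w.re ×ℂ uIcc 0 w.im ⊆ ball c r := by
    have := (convex_ball c r).rectangle_subset (z := (z.re : ℂ)) (w := w) hz0 hw
      (by simpa using hzw') (by simpa using hw0)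
    simpa [Rectangle] using this
  have hdiff : ∀ y₁ y₂ : ℝ, uIcc z.re w.re ×ℂ uIcc y₁ y₂ ⊆ ball c r → (y₁ = 0 ∨ y₂ = 0) →
      DifferentiableOn ℂ E (Ioo (min z.re w.re) (max z.re w.re) ×ℂ
        Ioo (min y₁ y₂) (max y₁ y₂)) := by
    intro y₁ y₂ hsub h0 p hp
    rw [mem_reProdIm] at hp
    refine (hd p (hsub ?_) ?_).differentiableWithinAt
    · exact ⟨Ioo_subset_Icc_self hp.1, Ioo_subset_Icc_self hp.2⟩
    · intro him
      rw [him] at hp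
      have h1 := min_lt_iff.1 hp.2.1
      have h2 := lt_max_iff.1 hp.2.2
      rcases h0 with h | h <;> subst h <;> simp at h1 h2 <;> linarith
  -- the two parts of the rectangle, below and above the real axis up to orientation
  have H1 := integral_boundary_rect_eq_zero_of_continuousOn_of_differentiableOn E z (w.re : ℂ)
    (by simpa using hE.mono hR1) (by simpa using hdiff _ _ hR1 (Or.inr rfl))
  have H2 := integral_boundary_rect_eq_zero_of_continuousOn_of_differentiableOn E (z.re : ℂ) w
    (by simpa using hE.mono hR2) (by simpa using hdiff _ _ hR2 (Or.inl rfl))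
  have hvert : ∀ x ∈ uIcc z.re w.re, ∀ y₁ y₂ : ℝ, uIcc z.re w.re ×ℂ uIcc y₁ y₂ ⊆ ball c r →
      IntervalIntegrable (fun y : ℝ => E (x + y * I)) volume y₁ y₂ := by
    intro x hx y₁ y₂ hsub
    apply ContinuousOn.intervalIntegrable
    refine hE.comp (by fun_prop) fun y hy => hsub ?_
    rw [mem_reProdIm]
    simpa using ⟨hx, hy⟩
  have V1 := intervalIntegral.integral_add_adjacent_intervals
    (hvert _ left_mem_uIcc _ _ hR1) (hvert _ left_mem_uIcc _ _ hR2)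
  have V2 := intervalIntegral.integral_add_adjacent_intervals
    (hvert _ right_mem_uIcc _ _ hR1) (hvert _ right_mem_uIcc _ _ hR2)
  rw [← add_eq_zero_iff_eq_neg, wedgeIntegral_add_wedgeIntegral_eq, ← V1, ← V2]
  simp only [ofReal_re, ofReal_im, smul_eq_mul] at H1 H2 ⊢
  linear_combination H1 + H2

open Complex in
/-- Schwarz reflection for `L^ρ` boundary values: two holomorphic functions above the real axis
whose boundary values are complex conjugate to each other continue each other analytically. The
primitives glue continuously, hence holomorphically, along the axis. -/
lemma exists_analytic_extension_of_conj_boundary {F H : ℂ → ℂ} {L : ℝ → ℂ} {α β η ρ : ℝ}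
    {B B' : ℝ≥0∞} (hη : 0 < η) (hρ : 1 < ρ) (hB : B ≠ ⊤) (hB' : B' ≠ ⊤)
    (hF : DifferentiableOn ℂ F (Ioo α β ×ℂ Ioo 0 η))
    (hFB : ∀ y ∈ Ioo 0 η, eLpNorm (fun x : ℝ => F (x + y * I)) (ENNReal.ofReal ρ)
      (volume.restrict (Ioo α β)) ≤ B)
    (hFL : ∀ᵐ x : ℝ ∂volume.restrict (Ioo α β),
      Tendsto (fun y : ℝ => F (x + y * I)) (𝓝[>] 0) (𝓝 (L x)))
    (hH : DifferentiableOn ℂ H (Ioo α β ×ℂ Ioo 0 η))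
    (hHB : ∀ y ∈ Ioo 0 η, eLpNorm (fun x : ℝ => H (x + y * I)) (ENNReal.ofReal ρ)
      (volume.restrict (Ioo α β)) ≤ B')
    (hHL : ∀ᵐ x : ℝ ∂volume.restrict (Ioo α β),
      Tendsto (fun y : ℝ => H (x + y * I)) (𝓝[>] 0) (𝓝 ((starRingEnd ℂ) (L x))))
    {x₁ : ℝ} (hx₁ : x₁ ∈ Ioo α β) :
    ∃ r > 0, ∃ E : ℂ → ℂ, DifferentiableOn ℂ E (ball x₁ r) ∧
      ∀ w ∈ ball (x₁ : ℂ) r, 0 < w.im → E w = F w := by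
  have hαβ : α < β := hx₁.1.trans hx₁.2
  obtain ⟨A, hAc, hAd, hAL⟩ := exists_primitive_continuousOn_boundary hαβ hη hρ hB hF hFB hFL
  obtain ⟨A', hAc', hAd', hAL'⟩ :=
    exists_primitive_continuousOn_boundary hαβ hη hρ hB' hH hHB hHL
  set r := min (min (x₁ - α) (β - x₁)) η with hr
  have hr0 : 0 < r := lt_min (lt_min (by linarith [hx₁.1]) (by linarith [hx₁.2])) hη
  have hball : ∀ w ∈ ball (x₁ : ℂ) r, w.re ∈ Ioo α β ∧ w.im ∈ Ioo (-η) η := by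
    intro w hw
    rw [mem_ball, dist_eq_norm] at hw
    have h1 := (abs_re_le_norm _).trans_lt hw
    have h2 := (abs_im_le_norm _).trans_lt hw
    simp only [sub_re, ofReal_re, sub_im, ofReal_im, sub_zero, abs_lt] at h1 h2
    have r1 : r ≤ x₁ - α := (min_le_left _ _).trans (min_le_left _ _)
    have r2 : r ≤ β - x₁ := (min_le_left _ _).trans (min_le_right _ _)
    have r3 : r ≤ η := min_le_right _ _
    refine ⟨⟨?_, ?_⟩, ?_, ?_⟩ <;> linarith [h1.1, h1.2, h2.1, h2.2]
  set E₁ : ℂ → ℂ := fun w => A w - A x₁ with hE₁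
  set E₂ : ℂ → ℂ := fun w => (starRingEnd ℂ) (A' ((starRingEnd ℂ) w) - A' x₁) with hE₂
  set E : ℂ → ℂ := fun w => if 0 ≤ w.im then E₁ w else E₂ w with hE
  have hEc : ContinuousOn E (ball x₁ r) := by
    refine ContinuousOn.if ?_ ?_ ?_
    · intro w hw
      have him : w.im = 0 := by
        have := hw.2
        rw [frontier_setOfPred_le_im] at this
        exact this
      have hwre : w = (w.re : ℂ) := by apply Complex.ext <;> simp [him]
      have hx := (hball w hw.1).1
      rw [hwre]
      simp only [hE₁, hE₂, conj_ofReal]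
      rw [hAL _ hx₁ _ hx, hAL' _ hx₁ _ hx]
      simp only [intervalIntegral, integral_conj, map_sub, conj_conj]
    · refine (hAc.mono ?_).sub continuousOn_const
      intro w hw
      have him : 0 ≤ w.im := by
        have := hw.2
        rw [(isClosed_le continuous_const continuous_im).closure_eq] at this
        exact this
      exact ⟨(hball w hw.1).1, him, (hball w hw.1).2.2⟩
    · refine continuous_conj.comp_continuousOn (ContinuousOn.sub ?_ continuousOn_const)
      refine hAc'.comp continuous_conj.continuousOn ?_
      intro w hw
      have him : w.im ≤ 0 := by
        have := hw.2
        simp only [not_le] at this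
        rw [closure_setOfPred_im_lt] at this
        exact this
      rw [mem_reProdIm, conj_re, conj_im]
      exact ⟨(hball w hw.1).1, by linarith, by linarith [(hball w hw.1).2.1]⟩
  have hEup : ∀ w ∈ ball (x₁ : ℂ) r, 0 < w.im → HasDerivAt E (F w) w := by
    intro w hw him
    have h1 : HasDerivAt E₁ (F w) w := (hAd w ⟨(hball w hw).1, him, (hball w hw).2.2⟩).sub_const _
    refine h1.congr_of_eventuallyEq ?_
    filter_upwards [(isOpen_lt continuous_const continuous_im).mem_nhds him] with v hv
    exact if_pos (le_of_lt hv)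
  have hEdown : ∀ w ∈ ball (x₁ : ℂ) r, w.im < 0 → DifferentiableAt ℂ E w := by
    intro w hw him
    have h0 : HasDerivAt (fun w => A' w - A' x₁) (H ((starRingEnd ℂ) w)) ((starRingEnd ℂ) w) := by
      refine (hAd' _ ?_).sub_const _
      rw [mem_reProdIm, conj_re, conj_im]
      exact ⟨(hball w hw).1, by linarith, by linarith [(hball w hw).2.1]⟩
    have h1 : HasDerivAt E₂ ((starRingEnd ℂ) (H ((starRingEnd ℂ) w))) w := by
      have := h0.conj_conj
      rw [Complex.conj_conj] at this
      exact this
    refine (h1.congr_of_eventuallyEq ?_).differentiableAt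
    filter_upwards [(isOpen_lt continuous_im continuous_const).mem_nhds him] with v hv
    exact if_neg (not_le.2 hv)
  have hEd : DifferentiableOn ℂ E (ball x₁ r) := by
    refine differentiableOn_ball_of_differentiableAt_off_real (ofReal_im x₁) hEc ?_
    intro w hw him
    rcases lt_or_gt_of_ne him with h | h
    · exact hEdown w hw h
    · exact (hEup w hw h).differentiableAt
  exact ⟨r, hr0, deriv E, hEd.deriv isOpen_ball, fun w hw him => (hEup w hw him).deriv⟩

/-! ### Reflection across the circle -/

lemma lintegral_circleMap_le_circleAverage {M : ℂ → ℝ} (hM : ContinuousOn M (ball 0 1))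
    (hM0 : ∀ z ∈ ball (0 : ℂ) 1, 0 ≤ M z) {r : ℝ} (hr : r ∈ Ioo (0 : ℝ) 1) {α β : ℝ}
    (hβ : β ≤ α + 2 * Real.pi) :
    ∫⁻ x in Ioo α β, ENNReal.ofReal (M (circleMap 0 r x)) ≤
      ENNReal.ofReal (2 * Real.pi * Real.circleAverage M 0 r) := by
  have hcm : ∀ t, circleMap 0 r t = (r : ℂ) * circleMap 0 1 t := fun t => by simp [circleMap_zero]
  have hmem : ∀ t, circleMap 0 r t ∈ ball (0 : ℂ) 1 := fun t => by
    rw [mem_ball_zero_iff, norm_circleMap_zero, abs_of_pos hr.1]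
    exact hr.2
  have hcont : Continuous fun t => M (circleMap 0 r t) :=
    hM.comp_continuous (continuous_circleMap 0 r) hmem
  have hint : IntegrableOn (fun t => M (circleMap 0 r t)) (Ioc α (α + 2 * Real.pi)) :=
    hcont.integrableOn_Ioc
  rw [Real.circleAverage_eq_circleAverage_zero_one, circleAverage_eq_integral_Ioc _ α,
    mul_inv_cancel_left₀ Real.two_pi_pos.ne']
  simp only [add_zero, ← hcm]
  rw [ofReal_integral_eq_lintegral_ofReal hint (Eventually.of_forall fun t => hM0 _ (hmem t))]
  exact lintegral_mono_set fun x hx => ⟨hx.1, hx.2.le.trans hβ⟩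

lemma eLpNorm_circleMap_le {f : ℂ → ℂ} {ρ α β B : ℝ} {M : ℂ → ℝ} (hρ : 0 < ρ)
    (hM : ContinuousOn M (ball 0 1)) (hM0 : ∀ z ∈ ball (0 : ℂ) 1, 0 ≤ M z)
    (hMB : ∀ r ∈ Ioo (0 : ℝ) 1, Real.circleAverage M 0 r ≤ B) {r : ℝ} (hr : r ∈ Ioo (0 : ℝ) 1)
    (hβ : β ≤ α + 2 * Real.pi)
    (hf : ∀ x ∈ Ioo α β, ‖f (circleMap 0 r x)‖ ^ ρ ≤ M (circleMap 0 r x)) :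
    eLpNorm (fun x => f (circleMap 0 r x)) (ENNReal.ofReal ρ) (volume.restrict (Ioo α β)) ≤
      ENNReal.ofReal (2 * Real.pi * B) ^ (1 / ρ) := by
  rw [eLpNorm_eq_lintegral_rpow_enorm_toReal (by simpa using hρ) ENNReal.ofReal_ne_top,
    ENNReal.toReal_ofReal hρ.le]
  refine ENNReal.rpow_le_rpow ?_ (by positivity)
  calc ∫⁻ x in Ioo α β, ‖f (circleMap 0 r x)‖ₑ ^ ρ
      ≤ ∫⁻ x in Ioo α β, ENNReal.ofReal (M (circleMap 0 r x)) := by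
        refine setLIntegral_mono' measurableSet_Ioo fun x hx => ?_
        rw [← ofReal_norm, ENNReal.ofReal_rpow_of_nonneg (norm_nonneg _) hρ.le]
        exact ENNReal.ofReal_le_ofReal (hf x hx)
    _ ≤ ENNReal.ofReal (2 * Real.pi * Real.circleAverage M 0 r) :=
        lintegral_circleMap_le_circleAverage hM hM0 hr hβ
    _ ≤ ENNReal.ofReal (2 * Real.pi * B) :=
        ENNReal.ofReal_le_ofReal (mul_le_mul_of_nonneg_left (hMB r hr) Real.two_pi_pos.le)

open Complex in
lemma cexp_mul_I_eq_circleMap (x y : ℝ) :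
    cexp ((x + y * I) * I) = circleMap 0 (Real.exp (-y)) x := by
  rw [circleMap_zero, ofReal_exp, ← Complex.exp_add]
  congr 1
  push_cast
  linear_combination (y : ℂ) * I_mul_I

open Complex in
/-- Reflection across the unit circle: if `f` and `h` are locally in `H^ρ`, `ρ > 1`, at a point of
the circle and have complex conjugate boundary values, then `f` continues analytically to a
neighbourhood of the point. -/
lemma exists_local_extension_of_conj_boundary {f h f' : ℂ → ℂ} {ρ δ θ : ℝ} (hρ : 1 < ρ)
    (hδ : 0 < δ) (hf : DifferentiableOn ℂ f (ball 0 1 ∩ ball (circleMap 0 1 θ) δ))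
    (hh : DifferentiableOn ℂ h (ball 0 1 ∩ ball (circleMap 0 1 θ) δ))
    (hfM : HasHardyMajorantOn f ρ (ball (circleMap 0 1 θ) δ))
    (hhM : HasHardyMajorantOn h ρ (ball (circleMap 0 1 θ) δ))
    (hfb : HasBoundaryFunction f f')
    (hhb : HasBoundaryFunction h (fun ζ => (starRingEnd ℂ) (f' ζ))) :
    ∃ r > 0, ∃ E : ℂ → ℂ, DifferentiableOn ℂ E (ball (circleMap 0 1 θ) r) ∧
      EqOn E f (ball (circleMap 0 1 θ) r ∩ ball 0 1) := by
  set ζ₀ := circleMap 0 1 θ with hζ₀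
  have hζ₀exp : ζ₀ = cexp (θ * I) := by simp [hζ₀, circleMap_zero]
  have hζ₀0 : ζ₀ ≠ 0 := by rw [hζ₀exp]; exact Complex.exp_ne_zero _
  have hζ₀n : ‖ζ₀‖ = 1 := by simp [hζ₀]
  obtain ⟨η, hη, hηpi, hηball⟩ : ∃ η > 0, η ≤ Real.pi ∧ ∀ w : ℂ, w.re ∈ Ioo (θ - η) (θ + η) →
      w.im ∈ Ioo 0 η → cexp (w * I) ∈ ball 0 1 ∩ ball ζ₀ δ := by
    have hc : ContinuousAt (fun w : ℂ => cexp (w * I)) θ := by fun_prop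
    obtain ⟨κ, hκ, hκb⟩ := Metric.continuousAt_iff.1 hc δ hδ
    refine ⟨min (κ / 2) Real.pi, by positivity, min_le_right _ _, fun w hre him => ⟨?_, ?_⟩⟩
    · rw [mem_ball_zero_iff, Complex.norm_exp]
      simpa using him.1
    · rw [mem_ball, hζ₀exp]
      refine hκb ?_
      have h1 : |(w - θ).re| < κ / 2 := by
        rw [sub_re, ofReal_re, abs_lt]
        have := min_le_left (κ / 2) Real.pi
        constructor <;> linarith [hre.1, hre.2]
      have h2 : |(w - θ).im| < κ / 2 := by
        rw [sub_im, ofReal_im, sub_zero, abs_of_pos him.1]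
        exact him.2.trans_le (min_le_left _ _)
      rw [dist_eq_norm]
      linarith [Complex.norm_le_abs_re_add_abs_im (w - θ)]
  have hmaps : MapsTo (fun w : ℂ => cexp (w * I)) (Ioo (θ - η) (θ + η) ×ℂ Ioo 0 η)
      (ball 0 1 ∩ ball ζ₀ δ) := fun w hw => hηball w hw.1 hw.2
  have hexpd : DifferentiableOn ℂ (fun w : ℂ => cexp (w * I))
      (Ioo (θ - η) (θ + η) ×ℂ Ioo 0 η) := by fun_prop
  have hrad : ∀ y ∈ Ioo 0 η, Real.exp (-y) ∈ Ioo (0 : ℝ) 1 := fun y hy =>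
    ⟨Real.exp_pos _, by simpa using hy.1⟩
  have hexplim : Tendsto (fun y : ℝ => Real.exp (-y)) (𝓝[>] 0) (𝓝[<] 1) := by
    refine tendsto_nhdsWithin_iff.2 ⟨?_, ?_⟩
    · have : Tendsto (fun y : ℝ => Real.exp (-y)) (𝓝 0) (𝓝 (Real.exp (-0))) :=
        (by fun_prop : Continuous fun y : ℝ => Real.exp (-y)).tendsto 0
      rw [neg_zero, Real.exp_zero] at this
      exact this.mono_left nhdsWithin_le_nhds
    · filter_upwards [self_mem_nhdsWithin] with y hy
      simpa using hy
  have hbd : ∀ k : ℂ → ℂ, HasHardyMajorantOn k ρ (ball ζ₀ δ) → ∃ B : ℝ≥0∞, B ≠ ⊤ ∧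
      ∀ y ∈ Ioo 0 η, eLpNorm (fun x : ℝ => k (cexp ((x + y * I) * I))) (ENNReal.ofReal ρ)
        (volume.restrict (Ioo (θ - η) (θ + η))) ≤ B := by
    rintro k ⟨M, B, hMc, hM0, hMB, hM⟩
    refine ⟨ENNReal.ofReal (2 * Real.pi * B) ^ (1 / ρ),
      ENNReal.rpow_ne_top_of_nonneg (by positivity) ENNReal.ofReal_ne_top, fun y hy => ?_⟩
    simp only [cexp_mul_I_eq_circleMap]
    refine eLpNorm_circleMap_le (by linarith) hMc hM0 hMB (hrad y hy) (by linarith) ?_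
    intro x hx
    rw [← cexp_mul_I_eq_circleMap]
    exact hM _ (hηball _ (by simpa using hx) (by simpa using hy))
  obtain ⟨B, hB, hfB⟩ := hbd f hfM
  obtain ⟨B', hB', hhB⟩ := hbd h hhM
  obtain ⟨κ, hκ, E, hE, hEf⟩ := exists_analytic_extension_of_conj_boundary
    (F := fun w => f (cexp (w * I))) (H := fun w => h (cexp (w * I)))
    (L := fun x => f' (circleMap 0 1 x)) hη hρ hB hB' (hf.comp hexpd hmaps) hfB
    (by
      filter_upwards [ae_restrict_of_ae hfb] with x hx
      simp only [cexp_mul_I_eq_circleMap]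
      exact hx.comp hexplim)
    (hh.comp hexpd hmaps) hhB
    (by
      filter_upwards [ae_restrict_of_ae hhb] with x hx
      simp only [cexp_mul_I_eq_circleMap]
      exact hx.comp hexplim)
    (x₁ := θ) ⟨by linarith, by linarith⟩
  -- the inverse branch of `w ↦ exp (i w)` that sends `ζ₀` to `θ`
  set W : ℂ → ℂ := fun z => θ - I * Complex.log (z / ζ₀) with hW
  have hWζ₀ : W ζ₀ = θ := by simp [hW, div_self hζ₀0]
  have hslit : ζ₀ / ζ₀ ∈ slitPlane := by simp [div_self hζ₀0]
  have hWc : ContinuousAt W ζ₀ := by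
    refine continuousAt_const.sub (continuousAt_const.mul ?_)
    exact (continuousAt_id.div_const ζ₀).clog hslit
  have hev1 : ∀ᶠ z in 𝓝 ζ₀, W z ∈ ball (θ : ℂ) κ :=
    hWc.eventually_mem (by rw [hWζ₀]; exact ball_mem_nhds _ hκ)
  have hev2 : ∀ᶠ z in 𝓝 ζ₀, z / ζ₀ ∈ slitPlane :=
    (continuousAt_id.div_const ζ₀).eventually_mem (isOpen_slitPlane.mem_nhds hslit)
  have hev3 : ∀ᶠ z in 𝓝 ζ₀, z ≠ 0 := isOpen_ne.mem_nhds hζ₀0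
  obtain ⟨r, hr, hrb⟩ := Metric.eventually_nhds_iff_ball.1 (hev1.and (hev2.and hev3))
  refine ⟨r, hr, fun z => E (W z), ?_, ?_⟩
  · refine hE.comp ?_ fun z hz => (hrb z hz).1
    intro z hz
    refine DifferentiableAt.differentiableWithinAt ?_
    refine (differentiableAt_const _).sub ((differentiableAt_const _).mul ?_)
    exact (differentiableAt_id.div_const ζ₀).clog (hrb z hz).2.1
  · rintro z ⟨hz, hz1⟩
    obtain ⟨h1, h2, h3⟩ := hrb z hz
    have hexpW : cexp (W z * I) = z := by
      have : W z * I = θ * I + Complex.log (z / ζ₀) := by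
        simp only [hW]
        linear_combination (-Complex.log (z / ζ₀)) * I_mul_I
      rw [this, Complex.exp_add, Complex.exp_log (div_ne_zero h3 hζ₀0), ← hζ₀exp]
      field_simp
    have him : 0 < (W z).im := by
      have h4 : ‖cexp (W z * I)‖ < 1 := by rw [hexpW]; simpa using hz1
      rw [Complex.norm_exp, Real.exp_lt_one_iff] at h4
      simpa using h4
    have := hEf (W z) h1 him
    simp only [hexpW] at this
    exact this

/-! ### Global continuation -/

/-- Local analytic continuations of `f` across points of the circle fit together, because two
intersecting disks centred on the circle meet inside the unit disk. -/
lemma extendsAnalyticallyAcross_of_local {f : ℂ → ℂ} {A : Set ℂ} (hA : A ⊆ sphere 0 1)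
    (hf : DifferentiableOn ℂ f (ball 0 1))
    (hloc : ∀ ζ : A, ∃ r > 0, ∃ E : ℂ → ℂ, DifferentiableOn ℂ E (ball ζ r) ∧
      EqOn E f (ball ζ r ∩ ball 0 1)) : ExtendsAnalyticallyAcross f A := by
  classical
  choose r hr E hE hEf using hloc
  have hcompat : ∀ ζ ζ' : A, EqOn (E ζ) (E ζ') (ball ζ (r ζ) ∩ ball ζ' (r ζ')) := by
    intro ζ ζ'
    rcases eq_or_ne ζ ζ' with rfl | hne
    · exact fun _ _ => rfl
    intro z hz
    set d := dist (ζ : ℂ) ζ' with hd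
    have hd0 : 0 < d := dist_pos.2 (Subtype.coe_injective.ne hne)
    have hdlt : d < r ζ + r ζ' := by
      have := dist_triangle_left (ζ : ℂ) ζ' z
      linarith [mem_ball.1 hz.1, mem_ball.1 hz.2]
    obtain ⟨t, ht1, ht2⟩ : ∃ t, max 0 (1 - r ζ' / d) < t ∧ t < min 1 (r ζ / d) := by
      refine exists_between (max_lt (lt_min one_pos (div_pos (hr ζ) hd0)) (lt_min ?_ ?_))
      · linarith [div_pos (hr ζ') hd0]
      · rw [sub_lt_iff_lt_add, ← add_div, lt_div_iff₀ hd0]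
        linarith
    have ht0 : 0 < t := (le_max_left _ _).trans_lt ht1
    have ht01 : t < 1 := ht2.trans_le (min_le_left _ _)
    set m : ℂ := (1 - t) • (ζ : ℂ) + t • (ζ' : ℂ) with hm
    have hm1 : m ∈ ball (0 : ℂ) 1 := combo_mem_ball_of_ne (sphere_subset_closedBall (hA ζ.2))
      (sphere_subset_closedBall (hA ζ'.2)) (Subtype.coe_injective.ne hne) (by linarith) ht0
      (by ring)
    have hmζ : m ∈ ball (ζ : ℂ) (r ζ) := by
      have : m - ζ = t • ((ζ' : ℂ) - ζ) := by
        simp only [hm, Complex.real_smul]; push_cast; ring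
      rw [mem_ball, dist_eq_norm, this, norm_smul, Real.norm_eq_abs, abs_of_pos ht0,
        ← dist_eq_norm, dist_comm, ← hd, ← lt_div_iff₀ hd0]
      exact ht2.trans_le (min_le_right _ _)
    have hmζ' : m ∈ ball (ζ' : ℂ) (r ζ') := by
      have : m - ζ' = (1 - t) • ((ζ : ℂ) - ζ') := by
        simp only [hm, Complex.real_smul]; push_cast; ring
      rw [mem_ball, dist_eq_norm, this, norm_smul, Real.norm_eq_abs, abs_of_pos (by linarith),
        ← dist_eq_norm, ← hd, ← lt_div_iff₀ hd0]
      linarith [(le_max_right _ _).trans_lt ht1]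
    have hV : IsOpen (ball (ζ : ℂ) (r ζ) ∩ ball (ζ' : ℂ) (r ζ')) := isOpen_ball.inter isOpen_ball
    have han : ∀ ξ : A, AnalyticOnNhd ℂ (E ξ) (ball ξ (r ξ)) := fun ξ =>
      (hE ξ).analyticOnNhd isOpen_ball
    refine ((han ζ).mono inter_subset_left).eqOn_of_preconnected_of_eventuallyEq
      ((han ζ').mono inter_subset_right)
      ((convex_ball _ _).inter (convex_ball _ _)).isPreconnected ⟨hmζ, hmζ'⟩ ?_ hz
    filter_upwards [hV.mem_nhds ⟨hmζ, hmζ'⟩, isOpen_ball.mem_nhds hm1] with v hv hv1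
    rw [hEf ζ ⟨hv.1, hv1⟩, hEf ζ' ⟨hv.2, hv1⟩]
  set F : ℂ → ℂ := fun z => if z ∈ ball (0 : ℂ) 1 then f z else
    if hz : ∃ ζ : A, z ∈ ball (ζ : ℂ) (r ζ) then E hz.choose z else 0 with hF
  have hFf : EqOn F f (ball 0 1) := fun z hz => if_pos hz
  have hFE : ∀ ζ : A, EqOn F (E ζ) (ball ζ (r ζ)) := by
    intro ζ z hz
    by_cases h1 : z ∈ ball (0 : ℂ) 1
    · rw [hFf h1, hEf ζ ⟨hz, h1⟩]
    · have h2 : ∃ ζ : A, z ∈ ball (ζ : ℂ) (r ζ) := ⟨ζ, hz⟩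
      simp only [hF, if_neg h1, dif_pos h2]
      exact hcompat _ _ ⟨h2.choose_spec, hz⟩
  refine ⟨ball 0 1 ∪ ⋃ ζ : A, ball (ζ : ℂ) (r ζ), F,
    isOpen_ball.union (isOpen_iUnion fun _ => isOpen_ball), subset_union_left, ?_, ?_, hFf⟩
  · intro ζ hζ
    exact Or.inr (mem_iUnion.2 ⟨⟨ζ, hζ⟩, mem_ball_self (hr _)⟩)
  · rintro z (hz | hz)
    · exact (hf.analyticOnNhd isOpen_ball z hz).congr
        (hFf.symm.eventuallyEq_of_mem (isOpen_ball.mem_nhds hz))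
    · obtain ⟨ζ, hζ⟩ := mem_iUnion.1 hz
      exact ((hE ζ).analyticOnNhd isOpen_ball z hζ).congr
        ((hFE ζ).symm.eventuallyEq_of_mem (isOpen_ball.mem_nhds hζ))

/-- An inner function is bounded away from zero near each point of the circle off its spectrum. -/
lemma exists_le_norm_of_notMem_innerSpectrum {I : ℂ → ℂ} {ζ : ℂ} (hζ : ζ ∈ closedBall (0 : ℂ) 1)
    (h : ζ ∉ innerSpectrum I) :
    ∃ ε > 0, ∃ δ > 0, ∀ z ∈ ball (0 : ℂ) 1 ∩ ball ζ δ, ε ≤ ‖I z‖ := by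
  have hne : liminf (fun z => ‖I z‖ₑ) (𝓝[ball 0 1] ζ) ≠ 0 := fun h0 => h ⟨hζ, h0⟩
  obtain ⟨c, hc0, hc⟩ := exists_between (pos_iff_ne_zero.2 hne)
  have hev := eventually_lt_of_lt_liminf hc
  obtain ⟨δ, hδ, hδb⟩ := Metric.mem_nhdsWithin_iff.1 hev
  refine ⟨c.toReal, ENNReal.toReal_pos hc0.ne' (ne_top_of_lt hc), δ, hδ, fun z hz => ?_⟩
  have h1 : c < ‖I z‖ₑ := hδb ⟨hz.2, hz.1⟩
  rw [← toReal_enorm]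
  exact ENNReal.toReal_mono enorm_ne_top h1.le

theorem theorem1 {p q : ℝ} (hp : 1 < p) (hq : 1 / p + 1 / q = 1)
    {g I : ℂ → ℂ} (hg : IsOuter g) (hgp : g ∈ HardySpace p) (hI : IsInner I)
    {a b : ℝ} (hab : a < b) (hba : b ≤ a + 2 * Real.pi)
    (hΓ : Disjoint (closedArc a b) (innerSpectrum I))
    (hs : ∃ s : ℝ≥0∞, ENNReal.ofReal q < s ∧ ∃ G : ℂ → ℂ, HasBoundaryFunction g G ∧
      MemLp (fun t : ℝ => 1 / G (circleMap 0 1 t)) s (volume.restrict (Icc a b))) :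
    ∀ f ∈ WeightedModelSpace p g I,
      ExtendsAnalyticallyAcross f (circleInterior (closedArc a b)) := by
  rintro f ⟨hf, ψ, hψ, -, f', I', ψ', hff', hII', hψψ', heq⟩
  obtain ⟨s', hs', G, hG, hmem'⟩ := hs
  obtain ⟨hId, -, I₁, hI₁, hI₁n⟩ := hI
  obtain ⟨u, hu, hgu⟩ := hg.exists_norm_eq
  have hq0 : 0 < q := by
    have : 1 / p < 1 := by rw [div_lt_one (by linarith)]; exact hp
    exact one_div_pos.1 (by linarith)
  -- a finite exponent between `q` and the given one
  obtain ⟨c, hqc, hcs⟩ := exists_between hs'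
  have hct : c ≠ ⊤ := ne_top_of_lt hcs
  set s := c.toReal with hsdef
  have hsc : ENNReal.ofReal s = c := ENNReal.ofReal_toReal hct
  have hqs : q < s := (ENNReal.ofReal_lt_iff_lt_toReal hq0.le hct).1 hqc
  have hs0 : 0 < s := hq0.trans hqs
  have hmem : MemLp (fun t : ℝ => 1 / G (circleMap 0 1 t)) (ENNReal.ofReal s)
      (volume.restrict (Icc a b)) := hmem'.mono_exponent (by rw [hsc]; exact hcs.le)
  set ρ := 1 / (1 / p + 1 / s) with hρdef
  have hsum : 1 / p + 1 / s < 1 := by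
    have := one_div_lt_one_div_of_lt hq0 hqs
    linarith
  have hsum0 : 0 < 1 / p + 1 / s := by positivity
  have hρ : 1 < ρ := by rw [hρdef, lt_div_iff₀ hsum0]; linarith
  have hρinv : 1 / ρ = 1 / p + 1 / s := by rw [hρdef, one_div_one_div]
  refine extendsAnalyticallyAcross_of_local (fun ζ hζ => hζ.1) hf.1 ?_
  rintro ⟨ζ, hζs, hζn⟩
  have hζarc : ζ ∈ closedArc a b := mem_of_mem_nhdsWithin hζs hζn
  obtain ⟨θ, -, rfl⟩ := id hζarc
  obtain ⟨ε, hε, δ₁, hδ₁, hIδ⟩ := exists_le_norm_of_notMem_innerSpectrum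
    (sphere_subset_closedBall hζs) (hΓ.notMem_of_mem_left hζarc)
  obtain ⟨δ₂, hδ₂, harc⟩ := Metric.mem_nhdsWithin_iff.1 hζn
  have hw := circleIntegrable_exp_indicator hu hs0 hba (hG.norm_eq_exp hu hgu a)
    measurableSet_ball harc hmem
  set δ := min δ₁ (δ₂ / 2) with hδdef
  have hδ : 0 < δ := by positivity
  have hsub1 : ball (circleMap 0 1 θ) δ ⊆ ball (circleMap 0 1 θ) δ₁ :=
    ball_subset_ball (min_le_left _ _)
  have hsub2 : ball (circleMap 0 1 θ) δ ⊆ closedBall (circleMap 0 1 θ) (δ₂ / 2) :=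
    (ball_subset_ball (min_le_right _ _)).trans ball_subset_closedBall
  have hp0 : 0 < p := by linarith
  have hρ0 : 0 < ρ := by linarith
  have hfM := hasHardyMajorantOn_of_mem_weightedHardySpace hp0 hs0 hρ0 hρinv hu hgu hδ₂ hw hf
  have hψM := hasHardyMajorantOn_of_mem_weightedHardySpace hp0 hs0 hρ0 hρinv hu hgu hδ₂ hw hψ
  refine exists_local_extension_of_conj_boundary (h := fun z => ψ z / I z) (f' := f') hρ hδ
    (hf.1.mono inter_subset_left) ?_
    (hfM.of_norm_le hρ0 zero_le_one hsub2 fun z _ => by rw [one_mul])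
    (hψM.of_norm_le hρ0 (C := ε⁻¹) (by positivity) hsub2 ?_) hff' ?_
  · refine (hψ.1.mono inter_subset_left).div (hId.mono inter_subset_left) fun z hz => ?_
    exact norm_pos_iff.1 (hε.trans_le (hIδ z ⟨hz.1, hsub1 hz.2⟩))
  · intro z hz
    rw [norm_div, div_eq_inv_mul]
    have := hIδ z ⟨hz.1, hsub1 hz.2⟩
    gcongr
  · filter_upwards [hII', hI₁, hI₁n, hψψ', heq] with t h1 h2 h3 h4 h5
    have hI'n : ‖I' (circleMap 0 1 t)‖ = 1 := by rw [tendsto_nhds_unique h1 h2, h3]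
    have hI'0 : I' (circleMap 0 1 t) ≠ 0 := norm_ne_zero_iff.1 (by rw [hI'n]; exact one_ne_zero)
    -- `conj (I' * conj ψ') = ψ' / I'` because `|I'| = 1`
    have hconj : (starRingEnd ℂ) (f' (circleMap 0 1 t)) =
        ψ' (circleMap 0 1 t) / I' (circleMap 0 1 t) := by
      rw [h5, map_mul, Complex.conj_conj, eq_div_iff hI'0, mul_right_comm, Complex.conj_mul', hI'n]
      simp
    rw [hconj]
    exact h4.div h1 hI'0
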